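/- Let $n\ge 0$ and let $G$ be $\mathrm{SO}_{2n+1}(\mathbb C)$ or $\mathrm{Sp}_{2n}(\mathbb C)$, realized as the group of matrices $g$ of determinant $1$ with $g^{t}Eg=E$, where $E$ is antidiagonal: for $\mathrm{SO}_{2n+1}$ all antidiagonal entries are $1$ except the middle one, which is $2$; for $\mathrm{Sp}_{2n}$ they are $-1$ in the first $n$ rows and $1$ in the last $n$ rows. Let $T\subset G$ be the maximal torus of the diagonal matrices $\mathbf t=\mathrm{diag}(t_1,\dots,t_n,1,t_n^{-1},\dots,t_1^{-1})$, respectively $\mathbf t=\mathrm{diag}(t_1,\dots,t_n,t_n^{-1},\dots,t_1^{-1})$, with $t_i\in\mathbb C^*$; let $\mathfrak t\subset\mathfrak g$ be the Lie algebras of $T$ and $G$, and let $W=N_G(T)/T$. Let $\mathrm{Rep}(G)$ be the representation ring of $G$ (finite-dimensional rational representations), virtual representations being identified with their characters restricted to $T$. Let $\lambda=\sum_{i\ge0}\lambda^i q^i:\mathrm{Rep}(G)\to\mathrm{Rep}(G)[[q]]$ be the unique map with $\lambda([V])=\sum_i[\Lambda^iV]q^i$ for every representation $V$ and $\lambda(x+y)=\lambda(x)\lambda(y)$;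 it makes $\mathrm{Rep}(G)$ a special $\lambda$-ring. That is, a commutative ring with $\lambda^0(x)=1$, $\lambda^1(x)=x$, $\lambda(x+y)=\lambda(x)\lambda(y)$, $\lambda(1)=1+q$, and for all $k,l\ge 1$ $$\lambda^k(xy)=P_k(\lambda^1(x),\dots,\lambda^k(x),\lambda^1(y),\dots,\lambda^k(y)),\qquad \lambda^k(\lambda^l(x))=P_{k,l}(\lambda^1(x),\dots,\lambda^{kl}(x)).$$ Here $P_k$ and $P_{k,l}$ are the universal integer polynomials such that $P_k(e_1(u),\dots,e_k(u),e_1(v),\dots,e_k(v))$ is the coefficient of $q^k$ in $\prod_{i,j=1}^k(1+u_iv_jq)$, and $P_{k,l}(e_1(u),\dots,e_{kl}(u))$ is the coefficient of $q^k$ in $\prod_{S\subset\{1,\dots,kl\},\,|S|=l}\bigl(1+q\prod_{i\in S}u_i\bigr)$, where $e_j$ denotes the $j$-th elementary symmetric polynomial. Let $V$ be the standard representation of $G$, and let $\theta:G\to\mathfrak g$ be its Springer morphism: $\theta(g)$ is the $\mathfrak g$-component of $g\in\mathrm{End}(V)=\mathfrak g\oplus\mathfrak g^{\perp}$, where $\mathfrak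 g^\perp$ is the orthogonal complement for the form $\langle A,B\rangle=\mathrm{tr}(AB)$. It maps $T$ to $\mathfrak t$. Let $\mathrm{Rep}^{\mathbb C}_{\mathrm{poly}}(G)$ be the algebra of the functions $p\circ\theta|_T$ on $T$, where $p$ runs over the $W$-invariant polynomial functions on $\mathfrak t$, and put $\mathrm{Rep}_{\mathrm{poly}}(G)=\mathrm{Rep}^{\mathbb C}_{\mathrm{poly}}(G)\cap\mathrm{Rep}(G)$. Then: (a) $\mathrm{Rep}_{\mathrm{poly}}(G)$ is a special $\lambda$-subring of $\mathrm{Rep}(G)$: it is a subring stable under all $\lambda^i$, and it is a special $\lambda$-ring for the restricted operations. (b) The function $\chi(\mathbf t)=\sum_{i=1}^n(t_i^2+t_i^{-2})$ belongs to $\mathrm{Rep}_{\mathrm{poly}}(G)$ and generates it as a $\lambda$-ring. More precisely, $\chi,\lambda^2(\chi),\dots,\lambda^n(\chi)$ generate the ring $\mathrm{Rep}_{\mathrm{poly}}(G)$; in particular, every subring of $\mathrm{Rep}(G)$ that contains $\chi$ and is stable under all $\lambda^i$ contains $\mathrm{Rep}_{\mathrm{poly}}(G)$. -/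

import Mathlib

open scoped Matrix

noncomputable section

namespace SpringerRep

/-! ### Special lambda-rings -/

/-- `P` is the universal polynomial `P_k` that expresses the `k`-th exterior power of a product:
in `k + k` variables `x_i`, `y_j`, substituting the elementary symmetric polynomials
`e_1(x), …, e_k(x), e_1(y), …, e_k(y)` in `P` gives the coefficient of `q ^ k` in
`∏_{i, j} (1 + x_i y_j q)`. This determines `P`. -/
def IsProductPolynomial (k : ℕ) (P : MvPolynomial (Fin k ⊕ Fin k) ℤ) : Prop :=
  MvPolynomial.aeval
      (Sum.elim
        (fun i : Fin k => MvPolynomial.rename Sum.inl (MvPolynomial.esymm (Fin k) ℤ (i + 1)))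
        (fun j : Fin k => MvPolynomial.rename Sum.inr (MvPolynomial.esymm (Fin k) ℤ (j + 1)))) P =
    (∏ i : Fin k, ∏ j : Fin k,
      ((1 : Polynomial (MvPolynomial (Fin k ⊕ Fin k) ℤ)) +
        Polynomial.C (MvPolynomial.X (Sum.inl i) * MvPolynomial.X (Sum.inr j)) *
          Polynomial.X)).coeff k

/-- `P` is the universal polynomial `P_{k,l}` that expresses the `k`-th exterior power of an
`l`-th exterior power: in `k * l` variables `x_i`, substituting the elementary symmetric
polynomials `e_1(x), …, e_{kl}(x)` in `P` gives the coefficient of `q ^ k` in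
`∏_{S} (1 + (∏_{i ∈ S} x_i) q)`, where `S` runs over the `l`-element sets of indices.
This determines `P`. -/
def IsCompositionPolynomial (k l : ℕ) (P : MvPolynomial (Fin (k * l)) ℤ) : Prop :=
  MvPolynomial.aeval
      (fun i : Fin (k * l) => MvPolynomial.esymm (Fin (k * l)) ℤ (i + 1)) P =
    (∏ S ∈ (Finset.univ : Finset (Fin (k * l))).powersetCard l,
      ((1 : Polynomial (MvPolynomial (Fin (k * l)) ℤ)) +
        Polynomial.C (∏ i ∈ S, MvPolynomial.X i) * Polynomial.X)).coeff k

/-- `lam : R → R[[q]]`, `x ↦ ∑ λ^i(x) q^i`, makes the commutative ring `R` a special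
lambda-ring. -/
structure IsSpecialLambdaRing {R : Type*} [CommRing R] (lam : R → PowerSeries R) : Prop where
  coeff_zero : ∀ x, PowerSeries.coeff 0 (lam x) = 1
  coeff_one : ∀ x, PowerSeries.coeff 1 (lam x) = x
  map_add : ∀ x y, lam (x + y) = lam x * lam y
  map_one : lam 1 = 1 + PowerSeries.X
  map_mul : ∀ k : ℕ, 1 ≤ k → ∃ P : MvPolynomial (Fin k ⊕ Fin k) ℤ, IsProductPolynomial k P ∧
    ∀ x y, PowerSeries.coeff k (lam (x * y)) =
      MvPolynomial.aeval
        (Sum.elim (fun i : Fin k => PowerSeries.coeff (i + 1 : ℕ) (lam x))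
          (fun j : Fin k => PowerSeries.coeff (j + 1 : ℕ) (lam y))) P
  comp : ∀ k l : ℕ, 1 ≤ k → 1 ≤ l →
    ∃ P : MvPolynomial (Fin (k * l)) ℤ, IsCompositionPolynomial k l P ∧
      ∀ x, PowerSeries.coeff k (lam (PowerSeries.coeff l (lam x))) =
        MvPolynomial.aeval (fun i : Fin (k * l) => PowerSeries.coeff (i + 1 : ℕ) (lam x)) P

/-- The subring `S` of `R` is stable under all the operations `λ^i`. -/
def IsLambdaStable {R : Type*} [CommRing R] (lam : R → PowerSeries R) (S : Subring R) : Prop :=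
  ∀ x ∈ S, ∀ i : ℕ, PowerSeries.coeff i (lam x) ∈ S

/-- The subring `S` of `R` is a special lambda-subring: it is stable under the operations `λ^i`
of `R`, and the restricted operations make it a special lambda-ring. -/
def IsSpecialLambdaSubring {R : Type*} [CommRing R] (lam : R → PowerSeries R)
    (S : Subring R) : Prop :=
  ∃ h : IsLambdaStable lam S,
    IsSpecialLambdaRing
      (fun x : S => PowerSeries.mk (fun i => (⟨PowerSeries.coeff i (lam x), h x x.2 i⟩ : S)))

/-! ### The groups `SO_{2n+1}` and `Sp_{2n}` -/

/-- The two families of groups: `B` for `SO_{2n+1}`, `C` for `Sp_{2n}`. -/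
inductive ClassicalType
  | B
  | C

/-- Dimension of the standard representation. -/
def dim : ClassicalType → ℕ → ℕ
  | .B, n => 2 * n + 1
  | .C, n => 2 * n

/-- The antidiagonal entries of the matrix of the form (0-based row index `i`). -/
def antidiagEntry : ClassicalType → ℕ → ℕ → ℂ
  | .B, n, i => if i = n then 2 else 1
  | .C, n, i => if i < n then -1 else 1

/-- The matrix `E` of the form. Type `B`: antidiagonal with entries `1`, except for the middle
entry `2`. Type `C`: antidiagonal with entries `-1` in the first `n` rows and `1` in the last
`n` rows. -/
def formMatrix (X : ClassicalType) (n : ℕ) : Matrix (Fin (dim X n)) (Fin (dim X n)) ℂ :=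
  Matrix.of fun i j => if j = i.rev then antidiagEntry X n i else 0

/-- `SO_{2n+1}` (type `B`) and `Sp_{2n}` (type `C`), as the group of the matrices of
determinant `1` that preserve the form `E`, that is `gᵀ E g = E`. -/
def classicalGroup (X : ClassicalType) (n : ℕ) :
    Subgroup (Matrix.SpecialLinearGroup (Fin (dim X n)) ℂ) where
  carrier := {g | g.1ᵀ * formMatrix X n * g.1 = formMatrix X n}
  one_mem' := by
    change (1 : Matrix (Fin (dim X n)) (Fin (dim X n)) ℂ)ᵀ * formMatrix X n * 1 = formMatrix X n
    rw [Matrix.transpose_one, Matrix.one_mul, Matrix.mul_one]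
  mul_mem' := by
    intro a b ha hb
    change (a.1 * b.1)ᵀ * formMatrix X n * (a.1 * b.1) = formMatrix X n
    calc (a.1 * b.1)ᵀ * formMatrix X n * (a.1 * b.1)
        = b.1ᵀ * (a.1ᵀ * formMatrix X n * a.1) * b.1 := by
          simp only [Matrix.transpose_mul, Matrix.mul_assoc]
      _ = formMatrix X n := by
          rw [show a.1ᵀ * formMatrix X n * a.1 = formMatrix X n from ha]
          exact hb
  inv_mem' := by
    intro a ha
    change (a⁻¹).1ᵀ * formMatrix X n * (a⁻¹).1 = formMatrix X n
    have h1 : a.1 * (a⁻¹).1 = 1 := congrArg Subtype.val (mul_inv_cancel a)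
    have h2 : (a⁻¹).1ᵀ * a.1ᵀ = 1 := by
      rw [← Matrix.transpose_mul, h1, Matrix.transpose_one]
    have ha' : a.1ᵀ * formMatrix X n * a.1 = formMatrix X n := ha
    calc (a⁻¹).1ᵀ * formMatrix X n * (a⁻¹).1
        = (a⁻¹).1ᵀ * (a.1ᵀ * formMatrix X n * a.1) * (a⁻¹).1 := by rw [ha']
      _ = ((a⁻¹).1ᵀ * a.1ᵀ) * formMatrix X n * (a.1 * (a⁻¹).1) := by
          simp only [Matrix.mul_assoc]
      _ = formMatrix X n := by rw [h1, h2, Matrix.one_mul, Matrix.mul_one]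

/-- The underlying matrix of an element of the group. -/
def toMat {X : ClassicalType} {n : ℕ} (g : classicalGroup X n) :
    Matrix (Fin (dim X n)) (Fin (dim X n)) ℂ :=
  ((g : Matrix.SpecialLinearGroup (Fin (dim X n)) ℂ) : Matrix _ _ ℂ)

/-! ### The maximal torus -/

/-- Diagonal entries of the element of the torus with coordinates `t_1, …, t_n`:
`t_1, …, t_n, t_n⁻¹, …, t_1⁻¹`, with a `1` in the middle for type `B`. -/
def torusEntry (X : ClassicalType) {n : ℕ} (t : Fin n → ℂˣ) (i : Fin (dim X n)) : ℂˣ :=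
  if h : (i : ℕ) < n then t ⟨i, h⟩
  else if h' : (i.rev : ℕ) < n then (t ⟨i.rev, h'⟩)⁻¹ else 1

theorem torusEntry_mul_rev (X : ClassicalType) {n : ℕ} (t : Fin n → ℂˣ) (i : Fin (dim X n)) :
    torusEntry X t i * torusEntry X t i.rev = 1 := by
  have hi := i.2
  have hr : (i.rev : ℕ) = dim X n - (i + 1) := Fin.val_rev i
  have hd : 2 * n ≤ dim X n := by cases X <;> simp [dim]
  unfold torusEntry
  by_cases h1 : (i : ℕ) < n
  · have h2 : ¬ (i.rev : ℕ) < n := by omega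
    simp [h1, h2, -Fin.val_rev]
  · by_cases h2 : (i.rev : ℕ) < n
    · simp [h1, h2, -Fin.val_rev]
    · simp [h1, h2, -Fin.val_rev]

theorem torusEntry_of_rev_eq (X : ClassicalType) {n : ℕ} (t : Fin n → ℂˣ) (i : Fin (dim X n))
    (h : i.rev = i) : torusEntry X t i = 1 := by
  have hi := i.2
  have hr : (i.rev : ℕ) = dim X n - (i + 1) := Fin.val_rev i
  have hd : 2 * n ≤ dim X n := by cases X <;> simp [dim]
  rw [h] at hr
  have h1 : ¬ (i : ℕ) < n := by omega
  have h2 : ¬ (i.rev : ℕ) < n := by rw [h]; exact h1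
  simp [torusEntry, h1, h2, -Fin.val_rev]

theorem prod_torusEntry (X : ClassicalType) {n : ℕ} (t : Fin n → ℂˣ) :
    ∏ i, torusEntry X t i = 1 := by
  refine Finset.prod_involution (fun i _ => i.rev) (fun i _ => torusEntry_mul_rev X t i) ?_
    (fun _ _ => Finset.mem_univ _) (fun i _ => Fin.rev_rev i)
  intro i _ h h'
  exact h (torusEntry_of_rev_eq X t i h')

/-- The parametrization `(ℂ^*)^n → G` of the maximal torus by its coordinates `t_1, …, t_n`. -/
def torusHom (X : ClassicalType) (n : ℕ) : (Fin n → ℂˣ) →* classicalGroup X n where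
  toFun t := ⟨⟨Matrix.diagonal fun i => (torusEntry X t i : ℂ), by
      rw [Matrix.det_diagonal, ← Units.coe_prod, prod_torusEntry, Units.val_one]⟩, by
      change (Matrix.diagonal fun i => (torusEntry X t i : ℂ))ᵀ * formMatrix X n *
        (Matrix.diagonal fun i => (torusEntry X t i : ℂ)) = formMatrix X n
      ext i j
      rw [Matrix.diagonal_transpose, Matrix.mul_diagonal, Matrix.diagonal_mul]
      by_cases h : j = i.rev
      · subst h
        have := congrArg Units.val (torusEntry_mul_rev X t i)
        rw [Units.val_mul, Units.val_one] at this
        rw [mul_right_comm, this, one_mul]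
      · simp [formMatrix, h]⟩
  map_one' := by
    apply Subtype.ext
    apply Subtype.ext
    change (Matrix.diagonal fun i => (torusEntry X 1 i : ℂ)) = 1
    have : (fun i => (torusEntry X (1 : Fin n → ℂˣ) i : ℂ)) = fun _ => 1 := by
      funext i
      simp [torusEntry]
    rw [this, Matrix.diagonal_one]
  map_mul' s t := by
    apply Subtype.ext
    apply Subtype.ext
    change (Matrix.diagonal fun i => (torusEntry X (s * t) i : ℂ)) =
      (Matrix.diagonal fun i => (torusEntry X s i : ℂ)) *
        (Matrix.diagonal fun i => (torusEntry X t i : ℂ))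
    rw [Matrix.diagonal_mul_diagonal]
    congr 1
    funext i
    unfold torusEntry
    split_ifs <;> simp [mul_comm]

/-- The maximal torus `T` of diagonal matrices in `G`. -/
def torus (X : ClassicalType) (n : ℕ) : Subgroup (classicalGroup X n) :=
  (torusHom X n).range

/-- The element of the Lie algebra of the torus with coordinates `x_1, …, x_n`: the diagonal matrix
with entries `x_1, …, x_n, -x_n, …, -x_1`, with a `0` in the middle for type `B`. -/
def torusLie (X : ClassicalType) {n : ℕ} (x : Fin n → ℂ) :
    Matrix (Fin (dim X n)) (Fin (dim X n)) ℂ :=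
  Matrix.diagonal fun i =>
    if h : (i : ℕ) < n then x ⟨i, h⟩ else if h' : (i.rev : ℕ) < n then -x ⟨i.rev, h'⟩ else 0

theorem le_dim (X : ClassicalType) (n : ℕ) : n ≤ dim X n := by
  cases X <;> simp only [dim] <;> omega

/-- The coordinates `x_1, …, x_n` on the Lie algebra of the torus (the first `n` diagonal
entries). -/
def lieCoord (X : ClassicalType) (n : ℕ) (A : Matrix (Fin (dim X n)) (Fin (dim X n)) ℂ) :
    Fin n → ℂ :=
  fun i => A (Fin.castLE (le_dim X n) i) (Fin.castLE (le_dim X n) i)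

theorem lieCoord_torusLie (X : ClassicalType) {n : ℕ} (x : Fin n → ℂ) :
    lieCoord X n (torusLie X x) = x := by
  funext i
  simp [lieCoord, torusLie]

/-! ### The Springer morphism for the standard representation -/

/-- The Lie algebra `𝔤 = {A | Aᵀ E + E A = 0}` of the group, inside `End(V) = Mat_N(ℂ)` for the
standard representation `V`. -/
def lieAlg (X : ClassicalType) (n : ℕ) :
    Submodule ℂ (Matrix (Fin (dim X n)) (Fin (dim X n)) ℂ) :=
  skewAdjointMatricesSubmodule (formMatrix X n)

/-- The orthogonal complement `𝔤^⊥` for the form `⟨A, B⟩ = tr (A B)` on `End(V)`. -/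
def lieAlgPerp (X : ClassicalType) (n : ℕ) :
    Submodule ℂ (Matrix (Fin (dim X n)) (Fin (dim X n)) ℂ) where
  carrier := {A | ∀ B ∈ lieAlg X n, (A * B).trace = 0}
  zero_mem' := by intro B _; simp
  add_mem' := by
    intro A A' hA hA' B hB
    rw [Matrix.add_mul, Matrix.trace_add, hA B hB, hA' B hB, add_zero]
  smul_mem' := by
    intro c A hA B hB
    rw [Matrix.smul_mul, Matrix.trace_smul, hA B hB, smul_zero]

theorem isCompl_of_form {N : ℕ} {E F : Matrix (Fin N) (Fin N) ℂ} {ε : ℂ} (hEF : E * F = 1)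
    (hε : ε * ε = 1) (hE : Eᵀ = ε • E)
    (L P : Submodule ℂ (Matrix (Fin N) (Fin N) ℂ))
    (hL : ∀ A, A ∈ L ↔ Aᵀ * E = E * (-A))
    (hP : ∀ A, A ∈ P ↔ ∀ B ∈ L, (A * B).trace = 0) : IsCompl L P := by
  have hFE : F * E = 1 := mul_eq_one_comm.mp hEF
  have key : ∀ A, (F * Aᵀ * E)ᵀ * E = E * A := by
    intro A
    have h1 : Fᵀ * E = ε • 1 := by
      have : Fᵀ * Eᵀ = 1 := by rw [← Matrix.transpose_mul, hEF, Matrix.transpose_one]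
      rw [hE, Matrix.mul_smul] at this
      rw [← this, smul_smul, hε, one_smul]
    rw [Matrix.transpose_mul, Matrix.transpose_mul, Matrix.transpose_transpose, hE]
    calc (ε • E) * (A * Fᵀ) * E = ε • (E * A * (Fᵀ * E)) := by
          simp only [Matrix.smul_mul, Matrix.mul_assoc]
      _ = E * A := by rw [h1, Matrix.mul_smul, smul_smul, hε, one_smul, Matrix.mul_one]
  have hEcancel : ∀ A, E * (F * A) = A := fun A => by rw [← Matrix.mul_assoc, hEF, Matrix.one_mul]
  have hFcancel : ∀ A, F * (E * A) = A := fun A => by rw [← Matrix.mul_assoc, hFE, Matrix.one_mul]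
  have hskew : ∀ A, A - F * Aᵀ * E ∈ L := by
    intro A
    rw [hL, Matrix.transpose_sub, Matrix.sub_mul, key, neg_sub, Matrix.mul_sub]
    simp only [Matrix.mul_assoc, hEcancel]
  have hsym : ∀ A, A + F * Aᵀ * E ∈ P := by
    intro A
    rw [hP]
    intro B hB
    rw [hL] at hB
    have hB' : F * (Bᵀ * E) = -B := by rw [hB, hFcancel]
    have : (F * Aᵀ * E * B).trace = -(A * B).trace := by
      calc (F * Aᵀ * E * B).trace = (Aᵀ * (E * B * F)).trace := by
            rw [Matrix.mul_assoc, Matrix.mul_assoc, Matrix.trace_mul_comm]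
            simp only [Matrix.mul_assoc]
        _ = (Aᵀ * (-(Bᵀ))).trace := by
            have h : E * B = -(Bᵀ * E) := by rw [hB, Matrix.mul_neg, neg_neg]
            rw [h, Matrix.neg_mul, Matrix.mul_assoc, hEF, Matrix.mul_one]
        _ = -(A * B).trace := by
            rw [Matrix.mul_neg, Matrix.trace_neg, ← Matrix.transpose_mul, Matrix.trace_transpose,
              Matrix.trace_mul_comm]
    rw [Matrix.add_mul, Matrix.trace_add, this, add_neg_cancel]
  have hdec : ∀ A : Matrix (Fin N) (Fin N) ℂ,
      (2⁻¹ : ℂ) • (A - F * Aᵀ * E) + (2⁻¹ : ℂ) • (A + F * Aᵀ * E) = A := by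
    intro A
    rw [← smul_add, sub_add_add_cancel, ← two_smul ℂ A, smul_smul]
    norm_num
  constructor
  · rw [Submodule.disjoint_def]
    intro A hA hA'
    have hz : ∀ B, (A * B).trace = 0 := by
      intro B
      rw [← hdec B, Matrix.mul_add, Matrix.trace_add]
      have h1 := (hP A).1 hA' _ (L.smul_mem (2⁻¹ : ℂ) (hskew B))
      have h2 := (hP _).1 (P.smul_mem (2⁻¹ : ℂ) (hsym B)) A hA
      rw [Matrix.trace_mul_comm] at h2
      rw [h1, h2, add_zero]
    ext i j
    have := hz (Matrix.single j i 1)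
    simpa [Matrix.trace_mul_single] using this
  · rw [codisjoint_iff, eq_top_iff]
    intro A _
    rw [← hdec A]
    exact Submodule.add_mem_sup (L.smul_mem _ (hskew A)) (P.smul_mem _ (hsym A))

/-- `End(V) = 𝔤 ⊕ 𝔤^⊥`. -/
theorem isCompl_lieAlg (X : ClassicalType) (n : ℕ) : IsCompl (lieAlg X n) (lieAlgPerp X n) := by
  have hc : ∀ i, antidiagEntry X n i ≠ 0 := by
    intro i
    cases X <;> simp only [antidiagEntry] <;> split_ifs <;> norm_num
  let ε : ℂ := match X with
    | .B => 1
    | .C => -1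
  have hε : ε * ε = 1 := by cases X <;> norm_num [ε]
  have hrev : ∀ i : Fin (dim X n), antidiagEntry X n i.rev = ε * antidiagEntry X n i := by
    intro i
    have hi := i.2
    have hr : (i.rev : ℕ) = dim X n - (i + 1) := Fin.val_rev i
    cases X with
    | B =>
      have hd : dim .B n = 2 * n + 1 := rfl
      have : (i.rev : ℕ) = n ↔ (i : ℕ) = n := by omega
      simp only [antidiagEntry, ε, this, one_mul]
    | C =>
      have hd : dim .C n = 2 * n := rfl
      have : (i.rev : ℕ) < n ↔ ¬ (i : ℕ) < n := by omega
      simp only [antidiagEntry, ε, this]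
      split_ifs <;> norm_num
  refine isCompl_of_form (E := formMatrix X n)
    (F := Matrix.of fun i j => if j = i.rev then (antidiagEntry X n i.rev)⁻¹ else 0)
    (ε := ε) ?_ hε ?_ _ _ ?_ (fun A => Iff.rfl)
  · ext i j
    rw [Matrix.mul_apply, Finset.sum_eq_single i.rev]
    · by_cases h : i = j
      · subst h
        simp [formMatrix, hc, -Fin.val_rev]
      · have h' : ¬ j = i := fun e => h e.symm
        simp [formMatrix, h, h']
    · intro k _ hk
      simp [formMatrix, hk]
    · intro h
      exact absurd (Finset.mem_univ _) h
  · ext i j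
    by_cases h : j = i.rev
    · subst h
      simp [formMatrix, hrev, -Fin.val_rev]
    · have h' : ¬ i = j.rev := fun e => h (by rw [e, Fin.rev_rev])
      simp [formMatrix, h, h']
  · intro A
    exact mem_skewAdjointMatricesSubmodule _ _

/-- The Springer morphism `θ : G → 𝔤` (with values written in `End(V)`) of the standard
representation `V`: `g ∈ Aut(V) ⊆ End(V) = 𝔤 ⊕ 𝔤^⊥` is sent to its `𝔤`-component. -/
def springer (X : ClassicalType) (n : ℕ) (g : classicalGroup X n) :
    Matrix (Fin (dim X n)) (Fin (dim X n)) ℂ :=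
  (lieAlg X n).projection (lieAlgPerp X n) (isCompl_lieAlg X n) (toMat g)

/-! ### Polynomial characters -/

/-- Complex functions on the maximal torus, in the coordinates `t_1, …, t_n`. -/
abbrev TorusFun (n : ℕ) : Type := (Fin n → ℂˣ) → ℂ

/-- `S(𝔱^*)^W = ℂ[𝔱]^W`: the polynomial functions of the coordinates `x_1, …, x_n` on `𝔱` that are
invariant under the Weyl group `W = N_G(T) / T`, which acts on `𝔱` by conjugation. -/
def weylInvariants (X : ClassicalType) (n : ℕ) : Subalgebra ℂ (MvPolynomial (Fin n) ℂ) where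
  carrier := {p | ∀ g ∈ Subgroup.normalizer (torus X n : Set (classicalGroup X n)), ∀ x : Fin n → ℂ,
    MvPolynomial.eval (lieCoord X n (toMat g * torusLie X x * toMat g⁻¹)) p =
      MvPolynomial.eval x p}
  mul_mem' := by
    intro p q hp hq g hg x
    rw [map_mul, map_mul, hp g hg x, hq g hg x]
  add_mem' := by
    intro p q hp hq g hg x
    rw [map_add, map_add, hp g hg x, hq g hg x]
  algebraMap_mem' := by
    intro c g _ x
    simp [MvPolynomial.algebraMap_eq]

/-- The pullback `(θ|_T)^*` of polynomial functions on `𝔱` to functions on `T`. -/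
def springerPullback (X : ClassicalType) (n : ℕ) : MvPolynomial (Fin n) ℂ →ₐ[ℂ] TorusFun n :=
  AlgHom.pi fun t => MvPolynomial.aeval (lieCoord X n (springer X n (torusHom X n t)))

/-- `Rep^ℂ_poly(G)`: the image of `S(𝔱^*)^W` under `(θ|_T)^*`. -/
def repPolyC (X : ClassicalType) (n : ℕ) : Subalgebra ℂ (TorusFun n) :=
  (weylInvariants X n).map (springerPullback X n)

/-! ### The representation ring -/

/-- A finite-dimensional rational (algebraic) representation of the group: all the matrix
coefficients are polynomials in the matrix entries. -/
structure RationalRep (X : ClassicalType) (n : ℕ) where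
  V : Type
  [addCommGroup : AddCommGroup V]
  [module : Module ℂ V]
  [finite : FiniteDimensional ℂ V]
  ρ : Representation ℂ (classicalGroup X n) V
  rational : ∀ (v : V) (φ : Module.Dual ℂ V),
    ∃ p : MvPolynomial (Fin (dim X n) × Fin (dim X n)) ℂ, ∀ g : classicalGroup X n,
      φ (ρ g v) = MvPolynomial.eval (fun ij => toMat g ij.1 ij.2) p

attribute [instance] RationalRep.addCommGroup RationalRep.module RationalRep.finite

/-- The character of a representation, restricted to the maximal torus. -/
def RationalRep.char {X : ClassicalType} {n : ℕ} (M : RationalRep X n) : TorusFun n :=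
  fun t => LinearMap.trace ℂ M.V (M.ρ (torusHom X n t))

/-- The character of the exterior power `Λ^i V`, restricted to the maximal torus. -/
def RationalRep.extChar {X : ClassicalType} {n : ℕ} (M : RationalRep X n) (i : ℕ) : TorusFun n :=
  fun t => LinearMap.trace ℂ (⋀[ℂ]^i M.V) (exteriorPower.map i (M.ρ (torusHom X n t)))

/-- The representation ring `Rep(G)`: the ring of virtual characters, as functions on the maximal
torus. (The characters are closed under products, by tensor products, so this is also the additive
group of differences of two characters.) -/
def repRing (X : ClassicalType) (n : ℕ) : Subring (TorusFun n) :=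
  Subring.closure (Set.range fun M : RationalRep X n => M.char)

/-- The class `[V]` in `Rep(G)` of a representation. -/
def RationalRep.toRepRing {X : ClassicalType} {n : ℕ} (M : RationalRep X n) : repRing X n :=
  ⟨M.char, Subring.subset_closure ⟨M, rfl⟩⟩

/-- `lam` is the operation `λ` of the representation ring: `λ([V]) = ∑ [Λ^i V] q^i` for every
representation `V`, and `λ(x + y) = λ(x) λ(y)`. -/
structure IsExteriorLambda {X : ClassicalType} {n : ℕ}
    (lam : repRing X n → PowerSeries (repRing X n)) : Prop where
  map_add : ∀ x y, lam (x + y) = lam x * lam y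
  rep : ∀ (M : RationalRep X n) (i : ℕ),
    ((PowerSeries.coeff i (lam M.toRepRing) : repRing X n) : TorusFun n) = M.extChar i

/-- `Rep_poly(G) = Rep^ℂ_poly(G) ∩ Rep(G)`, as a subring of `Rep(G)`. -/
def repPoly (X : ClassicalType) (n : ℕ) : Subring (repRing X n) :=
  (repPolyC X n).toSubring.comap (repRing X n).subtype

/-- The function `χ(t) = ∑ (t_i ^ 2 + t_i ^ (-2))` on the maximal torus. -/
def chi (n : ℕ) : TorusFun n :=
  fun t => ∑ i, ((t i : ℂ) ^ 2 + (t i : ℂ) ^ (-2 : ℤ))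

end SpringerRep

end

noncomputable section

namespace SpringerRep

/-! ### Newton series -/

/-! The λ-structure is defined on all complex functions on the torus `T`, by Newton's formulas from
the Adams operations `x ↦ (t ↦ x (t ^ i))`; this is `lamFun`. The Adams operations are ring
homomorphisms, and the `i`-th followed by the `j`-th is the `ij`-th. This gives the special λ-ring
axioms: by `exists_powerSum_eq`, any complex sequence is, up to a given degree, a sequence of power
sums of complex numbers, and for power sums the axioms are the defining identities of `P_k` and
`P_{k,l}`. A rational representation is diagonalizable on `T`, so the character of `Λ^k V` is the
`k`-th elementary symmetric function of the weights, which is `lamFun` of the character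
(`RationalRep.extChar_eq`). Hence `Rep(G)` is a λ-stable subring. The operation is unique because
`Rep(G)` is additively generated by classes of representations.

For the Springer morphism, the diagonal matrix `t` has `𝔤`-component `(t - t⁻¹) / 2`, so the
coordinates on `𝔱` pull back to `x_i = (t_i - t_i⁻¹) / 2`, and `4 x_i ^ 2 + 2 = t_i ^ 2 + t_i ^ (-2)
=: y_i`. Explicit monomial matrices in the normalizer of `T` show that invariant polynomials are
symmetric and even in each `x_i`. Conversely, symmetric polynomials in the `x_i ^ 2` are invariant
because the power sums of the `4 x_i ^ 2 + 2` come from traces, which conjugation preserves. So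
`Rep^ℂ_poly(G)` consists of the symmetric polynomials in the `y_i` (`mem_repPolyC_iff`). A monomial
in the `y_i` has a leading character with coefficient `1`, so a polynomial in the `y_i` that is an
integral Laurent polynomial has integral coefficients (`exists_int_coeff`). Thus `Rep_poly(G)` is
the ring of integral symmetric polynomials in the `y_i`.

Finally `λ(χ) = ∏ (1 + t_j ^ 2 q) (1 + t_j ^ (-2) q) = ∏ (1 + y_j q + q ^ 2)`. Its coefficients of
degree `1, …, n` are unitriangular over `ℤ` in the elementary symmetric functions of the `y_j`, so
they generate the ring. Stability under all `λ^k` follows, since `λ^k (λ^i χ)` is an integral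
polynomial in the `λ^j χ`. -/

/-- The `k`-th elementary symmetric function, as a function of the power sums `p 1, …, p k`. -/
def newtonCoeff (p : ℕ → ℂ) : ℕ → ℂ
  | 0 => 1
  | k + 1 => (∑ i : Fin (k + 1), newtonCoeff p i * ((-1) ^ (k - i : ℕ) * p (k - i + 1))) / (k + 1)

/-- The power series `exp (∑ (-1) ^ (i - 1) p_i q ^ i / i)`. -/
def newtonSeries (p : ℕ → ℂ) : PowerSeries ℂ := PowerSeries.mk (newtonCoeff p)

/-- The logarithmic derivative of `newtonSeries p`. -/
def newtonLog (p : ℕ → ℂ) : PowerSeries ℂ := PowerSeries.mk fun i => (-1) ^ i * p (i + 1)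

theorem coeff_newtonSeries (p : ℕ → ℂ) (k : ℕ) :
    PowerSeries.coeff k (newtonSeries p) = newtonCoeff p k := PowerSeries.coeff_mk _ _

theorem newtonCoeff_zero (p : ℕ → ℂ) : newtonCoeff p 0 = 1 := by rw [newtonCoeff]

theorem newtonCoeff_succ (p : ℕ → ℂ) (k : ℕ) :
    newtonCoeff p (k + 1) * (k + 1) =
      ∑ i ∈ Finset.range (k + 1), newtonCoeff p i * ((-1) ^ (k - i : ℕ) * p (k - i + 1)) := by
  rw [newtonCoeff, div_mul_cancel₀ _ (Nat.cast_add_one_ne_zero k), Finset.sum_range]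

theorem constantCoeff_newtonSeries (p : ℕ → ℂ) :
    PowerSeries.constantCoeff (newtonSeries p) = 1 := by
  rw [← PowerSeries.coeff_zero_eq_constantCoeff_apply, coeff_newtonSeries, newtonCoeff_zero]

theorem derivative_newtonSeries (p : ℕ → ℂ) :
    PowerSeries.derivative ℂ (newtonSeries p) = newtonSeries p * newtonLog p := by
  ext k
  rw [PowerSeries.coeff_derivative, coeff_newtonSeries, newtonCoeff_succ, PowerSeries.coeff_mul,
    Finset.Nat.sum_antidiagonal_eq_sum_range_succ
      (fun i j => PowerSeries.coeff i (newtonSeries p) * PowerSeries.coeff j (newtonLog p))]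
  simp [coeff_newtonSeries, newtonLog]

/-- Uniqueness for the linear differential equation `F' = F * L`: the quotient of two solutions has
zero derivative, hence is constant in characteristic zero. -/
theorem eq_newtonSeries {p : ℕ → ℂ} {F : PowerSeries ℂ} (h0 : PowerSeries.constantCoeff F = 1)
    (hF : PowerSeries.derivative ℂ F = F * newtonLog p) : F = newtonSeries p := by
  have hN : PowerSeries.constantCoeff (newtonSeries p) ≠ 0 := by
    rw [constantCoeff_newtonSeries]; exact one_ne_zero
  have h : F * (newtonSeries p)⁻¹ = 1 := by
    apply PowerSeries.derivative.ext
    · rw [Derivation.leibniz, PowerSeries.derivative_inv', derivative_newtonSeries, hF,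
        PowerSeries.derivative_one, smul_eq_mul, smul_eq_mul]
      have := PowerSeries.mul_inv_cancel _ hN
      linear_combination (-F * (newtonSeries p)⁻¹ * newtonLog p) * this
    · rw [map_mul, h0, PowerSeries.constantCoeff_inv, constantCoeff_newtonSeries]
      simp
  calc F = F * (newtonSeries p)⁻¹ * newtonSeries p := by
        rw [mul_assoc, PowerSeries.inv_mul_cancel _ hN, mul_one]
    _ = newtonSeries p := by rw [h, one_mul]

theorem newtonSeries_add (p r : ℕ → ℂ) :
    newtonSeries (p + r) = newtonSeries p * newtonSeries r := by
  symm
  apply eq_newtonSeries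
  · rw [map_mul, constantCoeff_newtonSeries, constantCoeff_newtonSeries, one_mul]
  · have : newtonLog (p + r) = newtonLog p + newtonLog r := by
      ext i
      simp [newtonLog, mul_add]
    rw [Derivation.leibniz, derivative_newtonSeries, derivative_newtonSeries, this, smul_eq_mul,
      smul_eq_mul]
    ring

theorem newtonSeries_zero : newtonSeries 0 = 1 := by
  symm
  apply eq_newtonSeries
  · simp
  · have : newtonLog 0 = 0 := by ext i; simp [newtonLog]
    rw [this, mul_zero, PowerSeries.derivative_one]

/-- The logarithmic derivative of `1 + u q` is the geometric series `∑ (-1) ^ i u ^ (i + 1) q ^ i`.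
-/
theorem newtonSeries_pow (u : ℂ) :
    newtonSeries (fun i => u ^ i) = 1 + PowerSeries.C u * PowerSeries.X := by
  symm
  apply eq_newtonSeries
  · simp
  · rw [map_add, PowerSeries.derivative_one, Derivation.leibniz, PowerSeries.derivative_C,
      PowerSeries.derivative_X]
    ext k
    cases k with
    | zero => simp [newtonLog]
    | succ k =>
      simp only [zero_add, mul_zero, add_zero, smul_eq_mul, mul_one, add_mul, one_mul, map_add,
        mul_assoc, PowerSeries.coeff_C_mul, PowerSeries.coeff_succ_X_mul, newtonLog,
        PowerSeries.coeff_mk, PowerSeries.coeff_C, Nat.succ_ne_zero, if_false]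
      ring

theorem newtonSeries_powerSum {ι : Type*} (s : Finset ι) (u : ι → ℂ) :
    newtonSeries (fun i => ∑ j ∈ s, u j ^ i) =
      ∏ j ∈ s, (1 + PowerSeries.C (u j) * PowerSeries.X) := by
  classical
  induction s using Finset.induction_on with
  | empty => simpa using! newtonSeries_zero
  | insert a s ha ih =>
    have : (fun i => ∑ j ∈ insert a s, u j ^ i) = (fun i => u a ^ i) + fun i => ∑ j ∈ s, u j ^ i := by
      funext i
      simp [Finset.sum_insert ha]
    rw [this, newtonSeries_add, ih, newtonSeries_pow, Finset.prod_insert ha]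

theorem coeff_prod_one_add {R ι : Type*} [CommRing R] (s : Finset ι) (u : ι → R) (k : ℕ) :
    (∏ j ∈ s, (1 + Polynomial.C (u j) * Polynomial.X)).coeff k =
      ∑ t ∈ s.powersetCard k, ∏ j ∈ t, u j := by
  classical
  rw [Finset.prod_one_add, Polynomial.finsetSum_coeff,
    Finset.powersetCard_eq_filter, Finset.sum_filter]
  refine Finset.sum_congr rfl fun t _ => ?_
  rw [Finset.prod_mul_distrib, Finset.prod_const, ← map_prod, Polynomial.coeff_C_mul_X_pow]
  simp [eq_comm]

theorem newtonCoeff_powerSum {ι : Type*} (s : Finset ι) (u : ι → ℂ) (k : ℕ) :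
    newtonCoeff (fun i => ∑ j ∈ s, u j ^ i) k =
      (∏ j ∈ s, (1 + Polynomial.C (u j) * Polynomial.X)).coeff k := by
  rw [← coeff_newtonSeries, newtonSeries_powerSum, ← Polynomial.coeff_coe,
    ← Polynomial.coeToPowerSeries.ringHom_apply, map_prod Polynomial.coeToPowerSeries.ringHom]
  simp

theorem newtonCoeff_powerSum' {ι : Type*} (s : Finset ι) (u : ι → ℂ) (k : ℕ) :
    newtonCoeff (fun i => ∑ j ∈ s, u j ^ i) k = ∑ t ∈ s.powersetCard k, ∏ j ∈ t, u j := by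
  rw [newtonCoeff_powerSum, coeff_prod_one_add]

/-- The recursion up to index `k` reads only `p 1, …, p k`. The value `p 0` never enters, so the
number of summands in a power sum is irrelevant. -/
theorem newtonCoeff_congr {p r : ℕ → ℂ} {k : ℕ} (h : ∀ i, 1 ≤ i → i ≤ k → p i = r i) :
    newtonCoeff p k = newtonCoeff r k := by
  induction k using Nat.strong_induction_on with
  | _ k ih =>
    cases k with
    | zero => rw [newtonCoeff_zero, newtonCoeff_zero]
    | succ k =>
      apply mul_right_cancel₀ (b := ((k : ℂ) + 1)) (Nat.cast_add_one_ne_zero k)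
      rw [newtonCoeff_succ, newtonCoeff_succ]
      refine Finset.sum_congr rfl fun i hi => ?_
      have := Finset.mem_range.1 hi
      rw [ih i this (fun j h1 h2 => h j h1 (by omega)), h (k - i + 1) (by omega) (by omega)]

/-- Newton's identities are also triangular in the other direction: `p (k + 1)` occurs in the
identity of index `k + 1` only in the term `i = 0`, with coefficient `± 1`. -/
theorem powerSum_eq_of_newtonCoeff_eq {p r : ℕ → ℂ} {N : ℕ}
    (h : ∀ k, k ≤ N → newtonCoeff p k = newtonCoeff r k) :
    ∀ i, 1 ≤ i → i ≤ N → p i = r i := by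
  intro i
  induction i using Nat.strong_induction_on with
  | _ i ih =>
    intro h1 h2
    obtain ⟨k, rfl⟩ : ∃ k, i = k + 1 := ⟨i - 1, by omega⟩
    have e := newtonCoeff_succ p k
    rw [h _ h2, newtonCoeff_succ, Finset.sum_range_succ', Finset.sum_range_succ'] at e
    have : ∑ j ∈ Finset.range k, newtonCoeff p (j + 1) *
          ((-1) ^ (k - (j + 1) : ℕ) * p (k - (j + 1) + 1)) =
        ∑ j ∈ Finset.range k, newtonCoeff r (j + 1) *
          ((-1) ^ (k - (j + 1) : ℕ) * r (k - (j + 1) + 1)) := by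
      refine Finset.sum_congr rfl fun j hj => ?_
      have := Finset.mem_range.1 hj
      rw [h (j + 1) (by omega), ih (k - (j + 1) + 1) (by omega) (by omega) (by omega)]
    rw [this, newtonCoeff_zero, newtonCoeff_zero] at e
    have e' := add_left_cancel e
    simp only [one_mul, Nat.sub_zero] at e'
    exact (mul_left_cancel₀ (pow_ne_zero _ (neg_ne_zero.2 one_ne_zero)) e').symm

/-- Up to any given degree, every sequence is the sequence of power sums of finitely many complex
numbers. -/
theorem exists_powerSum_eq (p : ℕ → ℂ) (N : ℕ) :
    ∃ u : Fin N → ℂ, ∀ i, 1 ≤ i → i ≤ N → p i = ∑ j, u j ^ i := by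
  -- In `X ^ N + f` the coefficient of `X ^ (N - k)` is `newtonCoeff p k`. By Vieta, the negatives
  -- of the roots have these numbers as elementary symmetric functions.
  let f : Polynomial ℂ := ∑ i ∈ Finset.range N, Polynomial.C (newtonCoeff p (N - i)) * Polynomial.X ^ i
  have hf : f.degree < N := by
    refine (Polynomial.degree_sum_le _ _).trans_lt ?_
    refine (Finset.sup_lt_iff (WithBot.bot_lt_coe N)).2 fun i hi => ?_
    refine (Polynomial.degree_C_mul_X_pow_le _ _).trans_lt ?_
    exact WithBot.coe_lt_coe.2 (Finset.mem_range.1 hi)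
  have hmonic : (Polynomial.X ^ N + f).Monic := Polynomial.monic_X_pow_add hf
  have hdeg : (Polynomial.X ^ N + f).natDegree = N := by
    rw [Polynomial.natDegree_eq_of_degree_eq_some]
    rw [Polynomial.degree_add_eq_left_of_degree_lt] <;> simp [hf]
  have hsplit := IsAlgClosed.splits (Polynomial.X ^ N + f)
  have hcard : Multiset.card ((Polynomial.X ^ N + f).roots) = N := by
    rw [← hsplit.natDegree_eq_card_roots, hdeg]
  obtain ⟨v, hv⟩ : ∃ v : Fin N → ℂ, (Polynomial.X ^ N + f).roots = Finset.univ.val.map v := by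
    obtain ⟨l, hl⟩ := Quot.exists_rep (Polynomial.X ^ N + f).roots
    have hlen : l.length = N := by rw [← hcard, ← hl]; rfl
    subst hlen
    refine ⟨l.get, ?_⟩
    rw [← hl, Fin.univ_val_map, List.ofFn_get]
    rfl
  have hprod : Polynomial.X ^ N + f = ∏ j, (Polynomial.X + Polynomial.C (-v j)) := by
    have := hsplit.eq_prod_roots_of_monic hmonic
    rw [hv, Multiset.map_map] at this
    rw [this, Finset.prod]
    simp [sub_eq_add_neg]
  refine ⟨fun j => -v j, powerSum_eq_of_newtonCoeff_eq fun k hk => ?_⟩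
  rw [newtonCoeff_powerSum']
  have h1 := Finset.prod_X_add_C_coeff Finset.univ (fun j => -v j) (k := N - k) (by simp)
  rw [← hprod, Finset.card_univ, Fintype.card_fin, Nat.sub_sub_self hk] at h1
  rw [← h1, Polynomial.coeff_add, Polynomial.coeff_X_pow, Polynomial.finsetSum_coeff]
  simp only [Polynomial.coeff_C_mul_X_pow]
  rcases Nat.eq_zero_or_pos k with rfl | hk0
  · rw [newtonCoeff_zero, Finset.sum_eq_zero]
    · simp
    · intro i hi
      have := Finset.mem_range.1 hi
      rw [if_neg (by omega)]
  · rw [if_neg (by omega), zero_add, Finset.sum_eq_single (N - k)]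
    · rw [if_pos rfl, Nat.sub_sub_self hk]
    · intro i _ hi
      rw [if_neg hi.symm]
    · intro h
      exact absurd (Finset.mem_range.2 (by omega)) h

/-! ### Universal polynomials -/

theorem exists_aeval_esymm_of_isSymmetric {R : Type*} [CommRing R] {k : ℕ}
    {f : MvPolynomial (Fin k) R} (hf : f.IsSymmetric) :
    ∃ P : MvPolynomial (Fin k) R,
      MvPolynomial.aeval (fun i : Fin k => MvPolynomial.esymm (Fin k) R (i + 1)) P = f := by
  obtain ⟨P, hP⟩ := MvPolynomial.esymmAlgHom_surjective (σ := Fin k) (n := k) R (by simp) ⟨f, hf⟩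
  exact ⟨P, by rw [← MvPolynomial.esymmAlgHom_apply, hP]⟩

theorem isSymmetric_coeff {R σ : Type*} [CommRing R] {f : Polynomial (MvPolynomial σ R)}
    (hf : ∀ e : Equiv.Perm σ, f.map (MvPolynomial.rename (R := R) e).toRingHom = f) (k : ℕ) :
    (f.coeff k).IsSymmetric := by
  intro e
  conv_rhs => rw [← hf e]
  rw [Polynomial.coeff_map]
  rfl

/-- A permutation of the variables permutes the `l`-element index sets, so the product is symmetric
and the fundamental theorem on symmetric polynomials applies. -/
theorem exists_isCompositionPolynomial (k l : ℕ) :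
    ∃ P : MvPolynomial (Fin (k * l)) ℤ, IsCompositionPolynomial k l P := by
  refine exists_aeval_esymm_of_isSymmetric (isSymmetric_coeff (fun e => ?_) k)
  rw [Polynomial.map_prod]
  have : ∀ S : Finset (Fin (k * l)), Polynomial.map (MvPolynomial.rename (R := ℤ) e).toRingHom
      (1 + Polynomial.C (∏ i ∈ S, MvPolynomial.X i) * Polynomial.X) =
      1 + Polynomial.C (∏ i ∈ S.map e.toEmbedding, MvPolynomial.X i) * Polynomial.X := by
    intro S
    simp [Finset.prod_map, Polynomial.map_prod]
  simp_rw [this]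
  refine Finset.prod_bij (fun S _ => S.map e.toEmbedding) ?_ ?_ ?_ (fun _ _ => rfl)
  · intro S hS
    simpa [Finset.mem_powersetCard] using hS
  · intro S _ S' _ h
    exact Finset.map_injective _ h
  · intro S hS
    refine ⟨S.map e.symm.toEmbedding, ?_, ?_⟩
    · simpa [Finset.mem_powersetCard] using hS
    · ext; simp

theorem aeval_esymm_eq_sum {R A σ : Type*} [CommRing R] [CommRing A] [Algebra R A] [Fintype σ]
    (u : σ → A) (k : ℕ) :
    MvPolynomial.aeval u (MvPolynomial.esymm σ R k) =
      ∑ t ∈ Finset.univ.powersetCard k, ∏ i ∈ t, u i := by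
  simp [MvPolynomial.esymm]

/-- The coefficient of `q ^ m` is `x ^ m e_m(v)`, and `e_m(v) = 0` for `m > k`. This expresses the
inner product of `P_k` through the elementary symmetric functions of one set of variables. -/
theorem prod_one_add_C_mul_eq {R : Type*} [CommRing R] {k : ℕ} (x : R) (v : Fin k → R) :
    ∏ j, (1 + Polynomial.C (x * v j) * Polynomial.X) =
      1 + ∑ l : Fin k, Polynomial.C ((∑ t ∈ Finset.univ.powersetCard (l + 1 : ℕ), ∏ j ∈ t, v j) *
        x ^ (l + 1 : ℕ)) * Polynomial.X ^ (l + 1 : ℕ) := by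
  ext m
  rw [coeff_prod_one_add, Polynomial.coeff_add, Polynomial.finsetSum_coeff]
  simp only [Polynomial.coeff_C_mul_X_pow]
  rcases Nat.eq_zero_or_pos m with rfl | hm
  · simp
  · rw [Polynomial.coeff_one, if_neg hm.ne', zero_add]
    have hprod : ∑ t ∈ Finset.univ.powersetCard m, ∏ j ∈ t, x * v j =
        (∑ t ∈ Finset.univ.powersetCard m, ∏ j ∈ t, v j) * x ^ m := by
      rw [Finset.sum_mul]
      refine Finset.sum_congr rfl fun t ht => ?_
      rw [Finset.prod_mul_distrib, Finset.prod_const, (Finset.mem_powersetCard.1 ht).2, mul_comm]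
    rw [hprod]
    by_cases hmk : m ≤ k
    · rw [Finset.sum_eq_single (⟨m - 1, by omega⟩ : Fin k)]
      · have : m - 1 + 1 = m := by omega
        simp [this]
      · intro b _ hb
        rw [if_neg]
        intro h
        exact hb (Fin.ext (by simp; omega))
      · intro h
        exact absurd (Finset.mem_univ _) h
    · rw [Finset.powersetCard_eq_empty.2 (by simpa using hmk), Finset.sum_empty, zero_mul]
      symm
      refine Finset.sum_eq_zero fun b _ => if_neg ?_
      have := b.2
      omega

/-- The fundamental theorem is needed only for the `x`-variables: the elementary symmetric functions
of the `y`-variables are first replaced by independent indeterminates, which are treated as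
coefficients. -/
theorem exists_isProductPolynomial (k : ℕ) :
    ∃ P : MvPolynomial (Fin k ⊕ Fin k) ℤ, IsProductPolynomial k P := by
  let R := MvPolynomial (Fin k) ℤ
  let F : Polynomial (MvPolynomial (Fin k) R) :=
    ∏ i : Fin k, (1 + ∑ l : Fin k, Polynomial.C (MvPolynomial.C (MvPolynomial.X l : R) *
      MvPolynomial.X i ^ (l + 1 : ℕ)) * Polynomial.X ^ (l + 1 : ℕ))
  have hF : (F.coeff k).IsSymmetric := by
    refine isSymmetric_coeff (fun e => ?_) k
    rw [Polynomial.map_prod]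
    refine Fintype.prod_equiv e _ _ fun i => ?_
    simp [Polynomial.map_sum]
  obtain ⟨P₀, hP₀⟩ := exists_aeval_esymm_of_isSymmetric hF
  let A : Type := MvPolynomial (Fin k ⊕ Fin k) ℤ
  let φ : R →+* A := (MvPolynomial.rename Sum.inr).toRingHom
  refine ⟨MvPolynomial.eval₂Hom φ (fun i => MvPolynomial.X (Sum.inl i)) P₀, ?_⟩
  unfold IsProductPolynomial
  -- `β` specializes the indeterminates to the elementary symmetric functions of the `y`-variables,
  -- and `ψ` extends it to the `x`-variables. Applied to `F`, `ψ` gives back the double product.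
  let β : R →+* A := (MvPolynomial.aeval fun j : Fin k =>
    (MvPolynomial.rename Sum.inr (MvPolynomial.esymm (Fin k) ℤ (j + 1)) : A)).toRingHom
  let ψ : MvPolynomial (Fin k) R →+* A :=
    MvPolynomial.eval₂Hom β fun i => MvPolynomial.X (Sum.inl i)
  have hψ : ∀ i : ℕ, ψ (MvPolynomial.esymm (Fin k) R i) =
      MvPolynomial.rename Sum.inl (MvPolynomial.esymm (Fin k) ℤ i) := by
    intro i
    simp [ψ, MvPolynomial.esymm]
  have h1 : ∀ Q : MvPolynomial (Fin k) R, MvPolynomial.aeval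
      (Sum.elim
        (fun i : Fin k => (MvPolynomial.rename Sum.inl (MvPolynomial.esymm (Fin k) ℤ (i + 1)) : A))
        (fun j : Fin k => (MvPolynomial.rename Sum.inr (MvPolynomial.esymm (Fin k) ℤ (j + 1)) : A)))
      (MvPolynomial.eval₂Hom φ (fun i => MvPolynomial.X (Sum.inl i)) Q) =
      ψ (MvPolynomial.aeval (fun i : Fin k => MvPolynomial.esymm (Fin k) R (i + 1)) Q) := by
    intro Q
    induction Q using MvPolynomial.induction_on with
    | C r =>
      simp only [MvPolynomial.eval₂Hom_C, MvPolynomial.aeval_C, MvPolynomial.algebraMap_eq, ψ, φ, β]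
      exact MvPolynomial.aeval_rename _ _ _
    | add p q hp hq => rw [map_add, map_add, hp, hq, map_add, map_add]
    | mul_X p i hp =>
      rw [map_mul, map_mul, hp, map_mul, map_mul]
      simp [hψ]
  refine (h1 P₀).trans ?_
  rw [hP₀]
  have h2 : ψ (F.coeff k) = (F.map ψ).coeff k := (Polynomial.coeff_map _ _).symm
  rw [h2]
  congr 1
  simp only [F]
  rw [Polynomial.map_prod]
  refine Finset.prod_congr rfl fun i _ => ?_
  rw [prod_one_add_C_mul_eq]
  have hβ : ∀ l : Fin k, β (MvPolynomial.X l) = ∑ t ∈ Finset.univ.powersetCard (l + 1 : ℕ),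
      ∏ j ∈ t, (MvPolynomial.X (Sum.inr j) : A) := by
    intro l
    refine (MvPolynomial.aeval_X _ l).trans ?_
    simp [MvPolynomial.esymm]
  simp [Polynomial.map_sum, ψ, hβ]

/-! ### The special lambda-ring of functions on a monoid -/

/-- Only degrees up to `k` matter, so `p` and `r` may be taken as the power sums of numbers `u_i`
and `v_j`. Then `p i * r i` is the power sum of the `u_i v_j`, and the claim is the defining
identity of `P` evaluated at `u` and `v`. -/
theorem newtonCoeff_mul {k : ℕ} {P : MvPolynomial (Fin k ⊕ Fin k) ℤ}
    (hP : IsProductPolynomial k P) (p r : ℕ → ℂ) :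
    newtonCoeff (fun i => p i * r i) k = MvPolynomial.aeval
      (Sum.elim (fun i : Fin k => newtonCoeff p (i + 1)) (fun j : Fin k => newtonCoeff r (j + 1)))
      P := by
  obtain ⟨u, hu⟩ := exists_powerSum_eq p k
  obtain ⟨v, hv⟩ := exists_powerSum_eq r k
  have hp : ∀ i : Fin k, newtonCoeff p (i + 1) = MvPolynomial.aeval u
      (MvPolynomial.esymm (Fin k) ℤ (i + 1)) := by
    intro i
    rw [aeval_esymm_eq_sum, ← newtonCoeff_powerSum']
    exact newtonCoeff_congr fun j h1 h2 => hu j h1 (by omega)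
  have hr : ∀ i : Fin k, newtonCoeff r (i + 1) = MvPolynomial.aeval v
      (MvPolynomial.esymm (Fin k) ℤ (i + 1)) := by
    intro i
    rw [aeval_esymm_eq_sum, ← newtonCoeff_powerSum']
    exact newtonCoeff_congr fun j h1 h2 => hv j h1 (by omega)
  have hl : newtonCoeff (fun i => p i * r i) k =
      newtonCoeff (fun i => ∑ a : Fin k × Fin k, (u a.1 * v a.2) ^ i) k := by
    refine newtonCoeff_congr fun i h1 h2 => ?_
    rw [hu i h1 h2, hv i h1 h2, Finset.sum_mul_sum, Fintype.sum_prod_type]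
    simp [mul_pow]
  have h := congrArg (MvPolynomial.aeval (Sum.elim u v) : _ →ₐ[ℤ] ℂ) hP
  rw [← AlgHom.comp_apply, MvPolynomial.comp_aeval] at h
  have hvar : (fun i => (MvPolynomial.aeval (Sum.elim u v) : _ →ₐ[ℤ] ℂ) (Sum.elim
        (fun i : Fin k => MvPolynomial.rename Sum.inl (MvPolynomial.esymm (Fin k) ℤ (i + 1)))
        (fun j : Fin k => MvPolynomial.rename Sum.inr (MvPolynomial.esymm (Fin k) ℤ (j + 1))) i)) =
      Sum.elim (fun i : Fin k => newtonCoeff p (i + 1))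
        (fun j : Fin k => newtonCoeff r (j + 1)) := by
    funext i
    rcases i with i | i
    · simp [MvPolynomial.aeval_rename, Function.comp_def, hp]
    · simp [MvPolynomial.aeval_rename, Function.comp_def, hr]
  rw [hvar] at h
  rw [h, hl, newtonCoeff_powerSum, Fintype.prod_prod_type, ← AlgHom.coe_toRingHom,
    ← Polynomial.coeff_map]
  simp [Polynomial.map_prod]

/-- Only the values `p (i * j)` with `1 ≤ i * j ≤ k * l` matter, so `p` may be taken as the power
sums of `k * l` numbers `u_a`. The inner coefficient is then `e_l` of the `u_a ^ i`, which is the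
`i`-th power sum of the products `∏_{a ∈ S} u_a` with `|S| = l`. -/
theorem newtonCoeff_comp {k l : ℕ} {P : MvPolynomial (Fin (k * l)) ℤ}
    (hP : IsCompositionPolynomial k l P) (p : ℕ → ℂ) :
    newtonCoeff (fun i => newtonCoeff (fun j => p (i * j)) l) k =
      MvPolynomial.aeval (fun i : Fin (k * l) => newtonCoeff p (i + 1)) P := by
  obtain ⟨u, hu⟩ := exists_powerSum_eq p (k * l)
  have hp : (fun i : Fin (k * l) => newtonCoeff p (i + 1)) = fun i : Fin (k * l) =>
      MvPolynomial.aeval u (MvPolynomial.esymm (Fin (k * l)) ℤ (i + 1)) := by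
    funext i
    rw [aeval_esymm_eq_sum, ← newtonCoeff_powerSum']
    exact newtonCoeff_congr fun j h1 h2 => hu j h1 (by omega)
  have hl : newtonCoeff (fun i => newtonCoeff (fun j => p (i * j)) l) k =
      newtonCoeff (fun i => ∑ S ∈ (Finset.univ : Finset (Fin (k * l))).powersetCard l,
        (∏ a ∈ S, u a) ^ i) k := by
    refine newtonCoeff_congr fun i h1 h2 => ?_
    have : newtonCoeff (fun j => p (i * j)) l = newtonCoeff (fun j => ∑ a, (u a ^ i) ^ j) l := by
      refine newtonCoeff_congr fun j h3 h4 => ?_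
      simp_rw [← pow_mul]
      exact hu _ (Nat.mul_pos h1 h3) (Nat.mul_le_mul h2 h4)
    rw [this, newtonCoeff_powerSum']
    simp [Finset.prod_pow]
  have h := congrArg (MvPolynomial.aeval u : _ →ₐ[ℤ] ℂ) hP
  rw [← AlgHom.comp_apply, MvPolynomial.comp_aeval, ← hp] at h
  rw [h, hl, newtonCoeff_powerSum, ← AlgHom.coe_toRingHom, ← Polynomial.coeff_map]
  simp [Polynomial.map_prod]

/-- The lambda-operation on complex functions on a monoid whose Adams operations are the
pullbacks along the power maps. -/
def lamFun {M : Type*} [Monoid M] (x : M → ℂ) : PowerSeries (M → ℂ) :=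
  PowerSeries.mk fun k t => newtonCoeff (fun i => x (t ^ i)) k

theorem coeff_lamFun {M : Type*} [Monoid M] (x : M → ℂ) (k : ℕ) (t : M) :
    PowerSeries.coeff k (lamFun x) t = newtonCoeff (fun i => x (t ^ i)) k := by
  rw [lamFun, PowerSeries.coeff_mk]

theorem map_aeval_int {R S σ : Type*} [CommRing R] [CommRing S] (f : R →+* S) (v : σ → R)
    (P : MvPolynomial σ ℤ) :
    f (MvPolynomial.aeval v P) = MvPolynomial.aeval (fun i => f (v i)) P :=
  MvPolynomial.comp_aeval_apply (f := v) f.toIntAlgHom P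

/-- Each axiom is checked at one point `t`, where it is a statement about the sequence `i ↦ x (t ^
i)`. Composition of the operations uses `(t ^ i) ^ j = t ^ (i * j)`. -/
theorem isSpecialLambdaRing_lamFun {M : Type*} [Monoid M] :
    IsSpecialLambdaRing (lamFun : (M → ℂ) → PowerSeries (M → ℂ)) where
  coeff_zero x := by
    funext t
    rw [coeff_lamFun, newtonCoeff_zero, Pi.one_apply]
  coeff_one x := by
    funext t
    have := newtonCoeff_succ (fun i => x (t ^ i)) 0
    rw [coeff_lamFun]
    simpa [newtonCoeff_zero] using this
  map_add x y := by
    ext k t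
    rw [coeff_lamFun, PowerSeries.coeff_mul, Finset.sum_apply]
    have := congrArg (PowerSeries.coeff k)
      (newtonSeries_add (fun i => x (t ^ i)) (fun i => y (t ^ i)))
    rw [coeff_newtonSeries, PowerSeries.coeff_mul] at this
    simp only [coeff_newtonSeries] at this
    simp only [Pi.mul_apply, coeff_lamFun]
    exact this
  map_one := by
    ext k t
    have := newtonSeries_pow 1
    simp only [one_pow, map_one, one_mul] at this
    rw [coeff_lamFun]
    simp only [Pi.one_apply]
    rw [← coeff_newtonSeries, this, map_add, map_add, Pi.add_apply, PowerSeries.coeff_one,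
      PowerSeries.coeff_one, PowerSeries.coeff_X, PowerSeries.coeff_X]
    congr 1 <;> split_ifs <;> rfl
  map_mul k _ := by
    obtain ⟨P, hP⟩ := exists_isProductPolynomial k
    refine ⟨P, hP, fun x y => ?_⟩
    funext t
    rw [coeff_lamFun]
    refine (newtonCoeff_mul hP (fun i => x (t ^ i)) (fun i => y (t ^ i))).trans
      (Eq.trans ?_ (map_aeval_int (Pi.evalRingHom (fun _ : M => ℂ) t) _ P).symm)
    congr 2
    funext i
    rcases i with i | i <;> simp [coeff_lamFun]
  comp k l _ _ := by
    obtain ⟨P, hP⟩ := exists_isCompositionPolynomial k l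
    refine ⟨P, hP, fun x => ?_⟩
    funext t
    rw [coeff_lamFun]
    refine Eq.trans ?_ (map_aeval_int (Pi.evalRingHom (fun _ : M => ℂ) t) _ P).symm
    simp only [Pi.evalRingHom_apply, coeff_lamFun, ← pow_mul]
    exact newtonCoeff_comp hP fun i => x (t ^ i)

/-! ### Subrings of special lambda-rings -/

theorem isSpecialLambdaRing_of_injective {R S : Type*} [CommRing R] [CommRing S] {f : R →+* S}
    (hf : Function.Injective f) {lamR : R → PowerSeries R} {lamS : S → PowerSeries S}
    (h : IsSpecialLambdaRing lamS)
    (hc : ∀ x k, f (PowerSeries.coeff k (lamR x)) = PowerSeries.coeff k (lamS (f x))) :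
    IsSpecialLambdaRing lamR where
  coeff_zero x := hf (by rw [hc, h.coeff_zero, map_one])
  coeff_one x := hf (by rw [hc, h.coeff_one])
  map_add x y := by
    ext k
    apply hf
    rw [hc, map_add, h.map_add, PowerSeries.coeff_mul, PowerSeries.coeff_mul, map_sum]
    simp [hc]
  map_one := by
    ext k
    apply hf
    rw [hc, map_one, h.map_one, map_add, map_add, map_add, PowerSeries.coeff_one,
      PowerSeries.coeff_one, PowerSeries.coeff_X, PowerSeries.coeff_X]
    congr 1 <;> split_ifs <;> simp
  map_mul k hk := by
    obtain ⟨P, hP, hxy⟩ := h.map_mul k hk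
    refine ⟨P, hP, fun x y => hf ?_⟩
    rw [hc, map_mul, hxy, map_aeval_int]
    congr 2
    funext i
    rcases i with i | i <;> simp [hc]
  comp k l hk hl := by
    obtain ⟨P, hP, hx⟩ := h.comp k l hk hl
    refine ⟨P, hP, fun x => hf ?_⟩
    rw [hc, hc, hx, map_aeval_int]
    simp only [hc]

theorem isSpecialLambdaSubring_of_isLambdaStable {R : Type*} [CommRing R]
    {lam : R → PowerSeries R} (h : IsSpecialLambdaRing lam) {S : Subring R}
    (hS : IsLambdaStable lam S) : IsSpecialLambdaSubring lam S :=
  ⟨hS, isSpecialLambdaRing_of_injective (f := S.subtype) Subtype.val_injective h fun x k => by simp⟩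

theorem aeval_int_mem {R σ : Type*} [CommRing R] (S : Subring R) {v : σ → R}
    (hv : ∀ i, v i ∈ S) (P : MvPolynomial σ ℤ) : MvPolynomial.aeval v P ∈ S := by
  have := map_aeval_int S.subtype (fun i => (⟨v i, hv i⟩ : S)) P
  simp only [Subring.subtype_apply] at this
  rw [← this]
  exact Subtype.property _

/-- The operations on sums and products are integral polynomials in the operations on the terms and
factors; those on `-x` follow recursively from `λ(x) λ(-x) = λ(0) = 1`. Hence stability has to be
tested only on ring generators. -/
theorem coeff_mem_of_mem_closure {R : Type*} [CommRing R]
    {lam : R → PowerSeries R} (h : IsSpecialLambdaRing lam) {s : Set R} {S : Subring R}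
    (hs : ∀ x ∈ s, ∀ k, PowerSeries.coeff k (lam x) ∈ S) {x : R}
    (hx : x ∈ Subring.closure s) (k : ℕ) : PowerSeries.coeff k (lam x) ∈ S := by
  have hone : ∀ k, PowerSeries.coeff k (lam 1) ∈ S := by
    intro k
    rw [h.map_one, map_add, PowerSeries.coeff_one, PowerSeries.coeff_X]
    split_ifs <;> simp [S.one_mem, S.zero_mem, S.add_mem]
  have hlam0 : lam 0 = 1 := by
    have hu : IsUnit (lam 1) := by
      rw [PowerSeries.isUnit_iff_constantCoeff, ← PowerSeries.coeff_zero_eq_constantCoeff_apply,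
        h.coeff_zero]
      exact isUnit_one
    have := h.map_add 1 0
    rw [add_zero] at this
    exact hu.mul_left_cancel (by rw [← this, mul_one])
  induction hx using Subring.closure_induction generalizing k with
  | mem x hx => exact hs x hx k
  | zero =>
    rw [hlam0, PowerSeries.coeff_one]
    split_ifs <;> simp [S.one_mem, S.zero_mem]
  | one => exact hone k
  | add x y _ _ hx hy =>
    rw [h.map_add, PowerSeries.coeff_mul]
    exact S.sum_mem fun a _ => S.mul_mem (hx _) (hy _)
  | neg x _ hx =>
    induction k using Nat.strong_induction_on with
    | _ k ih =>
      rcases Nat.eq_zero_or_pos k with rfl | hk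
      · rw [h.coeff_zero]; exact S.one_mem
      -- The coefficient of `q ^ k` in `λ(x) λ(-x) = 1` is solved for its term `λ^k(-x)`; the other
      -- terms involve only lower operations on `-x`.
      · have e := congrArg (PowerSeries.coeff k) (h.map_add x (-x))
        rw [add_neg_cancel, hlam0, PowerSeries.coeff_mul, PowerSeries.coeff_one, if_neg hk.ne',
          Finset.Nat.sum_antidiagonal_eq_sum_range_succ
            (fun i j => PowerSeries.coeff i (lam x) * PowerSeries.coeff j (lam (-x))),
          Finset.sum_range_succ', h.coeff_zero, one_mul, Nat.sub_zero] at e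
        rw [← neg_eq_of_add_eq_zero_right e.symm]
        refine S.neg_mem (S.sum_mem fun i hi => S.mul_mem (hx _) (ih _ ?_))
        omega
  | mul x y _ _ hx hy =>
    rcases Nat.eq_zero_or_pos k with rfl | hk
    · rw [h.coeff_zero]; exact S.one_mem
    · obtain ⟨P, -, hP⟩ := h.map_mul k hk
      rw [hP]
      refine aeval_int_mem S (fun i => ?_) P
      rcases i with i | i
      · exact hx _
      · exact hy _

/-! ### Characters of the torus -/

/-- The character `t ↦ ∏ t_i ^ (m_i)` of the torus. -/
def torusChar {n : ℕ} (m : Fin n → ℤ) : (Fin n → ℂˣ) →* ℂ where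
  toFun t := ((∏ i, t i ^ m i : ℂˣ) : ℂ)
  map_one' := by simp
  map_mul' s t := by simp [mul_zpow, Finset.prod_mul_distrib]

theorem torusChar_apply {n : ℕ} (m : Fin n → ℤ) (t : Fin n → ℂˣ) :
    torusChar m t = ((∏ i, t i ^ m i : ℂˣ) : ℂ) := rfl

theorem torusChar_add {n : ℕ} (m m' : Fin n → ℤ) :
    (⇑(torusChar (m + m')) : TorusFun n) = torusChar m * torusChar m' := by
  funext t
  simp [torusChar_apply, zpow_add, Finset.prod_mul_distrib]

theorem torusChar_zero {n : ℕ} : (⇑(torusChar (0 : Fin n → ℤ)) : TorusFun n) = 1 := by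
  funext t
  simp [torusChar_apply]

theorem torusChar_single {n : ℕ} (i : Fin n) (a : ℤ) (t : Fin n → ℂˣ) :
    torusChar (Pi.single i a) t = (t i : ℂ) ^ a := by
  rw [torusChar_apply, Finset.prod_eq_single i]
  · simp
  · intro j _ hj
    simp [hj]
  · simp

/-- The exponent `m i` is recovered from the value at the point with `i`-th coordinate `2` and all
other coordinates `1`. -/
theorem torusChar_injective {n : ℕ} :
    Function.Injective (torusChar : (Fin n → ℤ) → (Fin n → ℂˣ) →* ℂ) := by
  intro m m' h
  funext i
  have h2 : ((2 : ℂ) ≠ 0) := two_ne_zero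
  have key : ∀ m : Fin n → ℤ, torusChar m (Pi.mulSingle i (Units.mk0 2 h2)) = (2 : ℂ) ^ m i := by
    intro m
    rw [torusChar_apply, Finset.prod_eq_single i]
    · simp
    · intro j _ hj
      simp [hj]
    · simp
  have e : (2 : ℂ) ^ m i = (2 : ℂ) ^ m' i := by rw [← key, ← key, h]
  have e' : (2 : ℝ) ^ m i = (2 : ℝ) ^ m' i := by
    have := congrArg norm e
    simpa using this
  exact zpow_right_injective₀ (by norm_num) (by norm_num) e'

theorem linearIndependent_torusChar (n : ℕ) :
    LinearIndependent ℂ (fun m : Fin n → ℤ => (⇑(torusChar m) : TorusFun n)) :=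
  (linearIndependent_monoidHom (Fin n → ℂˣ) ℂ).comp _ torusChar_injective

/-- Laurent polynomial functions on the torus. -/
def laurent (n : ℕ) : Submodule ℂ (TorusFun n) :=
  Submodule.span ℂ (Set.range fun m : Fin n → ℤ => (⇑(torusChar m) : TorusFun n))

theorem laurent_mul_mem {n : ℕ} {f g : TorusFun n} (hf : f ∈ laurent n) (hg : g ∈ laurent n) :
    f * g ∈ laurent n := by
  have h : f * g ∈ laurent n * laurent n := Submodule.mul_mem_mul hf hg
  rw [laurent, Submodule.span_mul_span] at h
  refine Submodule.span_mono ?_ h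
  rintro _ ⟨_, ⟨m, rfl⟩, _, ⟨m', rfl⟩, rfl⟩
  exact ⟨m + m', torusChar_add m m'⟩

/-- Laurent polynomial functions on the torus, as a subalgebra. -/
def laurentAlg (n : ℕ) : Subalgebra ℂ (TorusFun n) :=
  (laurent n).toSubalgebra (Submodule.subset_span ⟨0, torusChar_zero⟩)
    fun _ _ => laurent_mul_mem

theorem torusEntry_mem_laurentAlg (X : ClassicalType) {n : ℕ} (i : Fin (dim X n)) :
    (fun t => (torusEntry X t i : ℂ)) ∈ laurentAlg n := by
  have h : ∃ m : Fin n → ℤ, (fun t => (torusEntry X t i : ℂ)) = torusChar m := by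
    by_cases h1 : (i : ℕ) < n
    · refine ⟨Pi.single ⟨i, h1⟩ 1, funext fun t => ?_⟩
      simp [torusEntry, h1, torusChar_single]
    · by_cases h2 : (i.rev : ℕ) < n
      · refine ⟨Pi.single ⟨i.rev, h2⟩ (-1), funext fun t => ?_⟩
        simp [torusEntry, h1, h2, torusChar_single, -Fin.val_rev]
      · refine ⟨0, funext fun t => ?_⟩
        simp [torusEntry, h1, h2, torusChar_zero, -Fin.val_rev]
  obtain ⟨m, hm⟩ := h
  rw [hm]
  exact Submodule.subset_span ⟨m, rfl⟩

theorem eval_torusHom_mem_laurent (X : ClassicalType) (n : ℕ)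
    (p : MvPolynomial (Fin (dim X n) × Fin (dim X n)) ℂ) :
    (fun t => MvPolynomial.eval (fun ij => toMat (torusHom X n t) ij.1 ij.2) p) ∈ laurent n := by
  change _ ∈ laurentAlg n
  induction p using MvPolynomial.induction_on with
  | C a =>
    simp only [MvPolynomial.eval_C]
    exact (laurentAlg n).algebraMap_mem a
  | add p q hp hq =>
    simp only [map_add]
    exact (laurentAlg n).add_mem hp hq
  | mul_X p ij hp =>
    simp only [map_mul, MvPolynomial.eval_X]
    refine (laurentAlg n).mul_mem hp ?_
    have h : ∀ t, toMat (torusHom X n t) ij.1 ij.2 =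
        if ij.1 = ij.2 then (torusEntry X t ij.1 : ℂ) else 0 := fun t => Matrix.diagonal_apply _ _ _
    simp only [h]
    split_ifs
    · exact torusEntry_mem_laurentAlg X ij.1
    · exact (laurentAlg n).zero_mem

/-! ### Weights of rational representations -/

/-- The matrix coefficients are Laurent polynomials on the torus. Collecting equal characters over
all coordinates gives an expansion with vector coefficients. -/
theorem RationalRep.exists_expansion {X : ClassicalType} {n : ℕ} (M : RationalRep X n) (v : M.V) :
    ∃ (s : Finset (Fin n → ℤ)) (w : (Fin n → ℤ) → M.V), ∀ t,
      M.ρ (torusHom X n t) v = ∑ m ∈ s, torusChar m t • w m := by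
  classical
  let b := Module.finBasis ℂ M.V
  have h : ∀ i, ∃ c : (Fin n → ℤ) →₀ ℂ, ∀ t,
      b.repr (M.ρ (torusHom X n t) v) i = ∑ m ∈ c.support, c m * torusChar m t := by
    intro i
    obtain ⟨p, hp⟩ := M.rational v (b.coord i)
    have := eval_torusHom_mem_laurent X n p
    obtain ⟨c, hc⟩ := Finsupp.mem_span_range_iff_exists_finsupp.1 this
    refine ⟨c, fun t => ?_⟩
    have h := congrFun hc t
    rw [← hp] at h
    rw [Module.Basis.coord_apply] at h
    rw [← h, Finsupp.sum, Finset.sum_apply]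
    simp
  choose c hc using h
  refine ⟨Finset.univ.biUnion fun i => (c i).support, fun m => ∑ i, c i m • b i, fun t => ?_⟩
  rw [← b.sum_repr (M.ρ (torusHom X n t) v)]
  simp only [Finset.smul_sum, smul_smul]
  rw [Finset.sum_comm]
  refine Finset.sum_congr rfl fun i _ => ?_
  rw [hc, Finset.sum_smul]
  refine Finset.sum_subset_zero_on_sdiff
    (Finset.subset_biUnion_of_mem (fun i => (c i).support) (Finset.mem_univ i)) ?_ ?_
  · intro m hm
    have : c i m = 0 := by simpa using (Finset.mem_sdiff.1 hm).2
    simp [this]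
  · intro m _
    rw [mul_comm]

/-- Linear functionals reduce this to the linear independence of characters with scalar
coefficients. -/
theorem eq_of_sum_torusChar_smul_eq {V : Type*} [AddCommGroup V] [Module ℂ V]
    {n : ℕ} {s : Finset (Fin n → ℤ)} {v w : (Fin n → ℤ) → V}
    (h : ∀ t, ∑ m ∈ s, torusChar m t • v m = ∑ m ∈ s, torusChar m t • w m) :
    ∀ m ∈ s, v m = w m := by
  intro m hm
  rw [← sub_eq_zero]
  refine (Module.forall_dual_apply_eq_zero_iff ℂ _).1 fun φ => ?_
  refine linearIndependent_iff'.1 (linearIndependent_torusChar n) s (fun m => φ (v m - w m)) ?_ m hm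
  funext t
  have := congrArg φ (sub_eq_zero.2 (h t))
  rw [← Finset.sum_sub_distrib, map_sum, map_zero] at this
  rw [Finset.sum_apply, Pi.zero_apply, ← this]
  refine Finset.sum_congr rfl fun m _ => ?_
  rw [← smul_sub, map_smul, Pi.smul_apply, smul_eq_mul, smul_eq_mul, mul_comm]

/-- The restriction to the torus of a rational representation is diagonalizable. -/
theorem RationalRep.exists_weightBasis {X : ClassicalType} {n : ℕ} (M : RationalRep X n) :
    ∃ (N : ℕ) (b : Module.Basis (Fin N) ℂ M.V) (w : Fin N → Fin n → ℤ), ∀ t i,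
      M.ρ (torusHom X n t) (b i) = torusChar (w i) t • b i := by
  classical
  let E : Set M.V := {v | ∃ m : Fin n → ℤ, ∀ t, M.ρ (torusHom X n t) v = torusChar m t • v}
  have hE : ⊤ ≤ Submodule.span ℂ E := by
    intro v _
    obtain ⟨s, w, hw⟩ := M.exists_expansion v
    have h1 : v = ∑ m ∈ s, w m := by
      have := hw 1
      simpa using this
    rw [h1]
    -- Each `w m` is a weight vector of weight `m`: both expressions for `ρ(t) ρ(t') v = ρ(t t') v`
    -- are expanded as functions of `t'`, and the coefficients of `torusChar m t'` are compared. The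
    -- value at `t = 1` has shown that `v` is the sum of the `w m`.
    refine Submodule.sum_mem _ fun m hm => Submodule.subset_span ⟨m, fun t => ?_⟩
    refine eq_of_sum_torusChar_smul_eq (s := s) (v := fun m => M.ρ (torusHom X n t) (w m))
      (w := fun m => torusChar m t • w m) (fun t' => ?_) m hm
    have e : M.ρ (torusHom X n t) (M.ρ (torusHom X n t') v) = M.ρ (torusHom X n (t * t')) v := by
      rw [map_mul, map_mul]; rfl
    rw [hw, hw, map_sum] at e
    simp only [map_smul, map_mul] at e
    rw [e]
    refine Finset.sum_congr rfl fun m _ => ?_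
    rw [smul_smul, mul_comm]
  let b₀ := Module.Basis.ofSpan hE
  have : Fintype _ := FiniteDimensional.fintypeBasisIndex b₀
  let b := b₀.reindex (Fintype.equivFin _)
  have hb : ∀ i, b i ∈ E := by
    intro i
    apply Module.Basis.ofSpan_subset hE
    rw [Module.Basis.reindex_apply]
    exact ⟨_, rfl⟩
  choose w hw using hb
  exact ⟨_, b, w, fun t i => hw i t⟩

theorem trace_eq_sum_of_eigenbasis {ι V : Type*} [Fintype ι] [AddCommGroup V]
    [Module ℂ V] (b : Module.Basis ι ℂ V) (f : V →ₗ[ℂ] V) (μ : ι → ℂ)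
    (h : ∀ i, f (b i) = μ i • b i) : LinearMap.trace ℂ V f = ∑ i, μ i := by
  classical
  rw [LinearMap.trace_eq_matrix_trace ℂ b, Matrix.trace]
  refine Finset.sum_congr rfl fun i _ => ?_
  rw [Matrix.diag_apply, LinearMap.toMatrix_apply, h]
  simp

/-- Wedge products of `k` distinct eigenvectors of the basis form an eigenbasis of `Λ^k V`, with
eigenvalues the products of the corresponding `μ j`. -/
theorem trace_exteriorPower_map {N : ℕ} {V : Type*} [AddCommGroup V] [Module ℂ V]
    (b : Module.Basis (Fin N) ℂ V) (f : V →ₗ[ℂ] V) (μ : Fin N → ℂ)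
    (h : ∀ i, f (b i) = μ i • b i) (k : ℕ) :
    LinearMap.trace ℂ (⋀[ℂ]^k V) (exteriorPower.map k f) =
      ∑ t ∈ Finset.univ.powersetCard k, ∏ j ∈ t, μ j := by
  classical
  have hb : ∀ s : Set.powersetCard (Fin N) k, exteriorPower.map k f (b.exteriorPower k s) =
      (∏ j ∈ (s : Finset (Fin N)), μ j) • b.exteriorPower k s := by
    intro s
    rw [exteriorPower.basis_apply, exteriorPower.map_apply_ιMulti_family,
      exteriorPower.ιMulti_family, exteriorPower.ιMulti_family]
    have h1 : (f ∘ b) ∘ Set.powersetCard.ofFinEmbEquiv.symm s = fun j =>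
        μ (Set.powersetCard.ofFinEmbEquiv.symm s j) •
          (b ∘ Set.powersetCard.ofFinEmbEquiv.symm s) j := funext fun j => h _
    rw [h1, AlternatingMap.map_smul_univ]
    congr 1
    refine Finset.prod_bij (fun j _ => Set.powersetCard.ofFinEmbEquiv.symm s j) ?_ ?_ ?_
      (fun _ _ => rfl)
    · intro j _
      exact (Set.powersetCard.mem_range_ofFinEmbEquiv_symm_iff_mem s _).1 ⟨j, rfl⟩
    · intro j _ j' _ e
      exact (Set.powersetCard.ofFinEmbEquiv.symm s).injective e
    · intro i hi
      obtain ⟨j, hj⟩ := (Set.powersetCard.mem_range_ofFinEmbEquiv_symm_iff_mem s i).2 hi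
      exact ⟨j, Finset.mem_univ _, hj⟩
  have : Fintype (Set.powersetCard (Fin N) k) := Fintype.ofFinite _
  rw [trace_eq_sum_of_eigenbasis (b.exteriorPower k) _ _ hb]
  exact (Finset.sum_subtype _ (fun s => by simp [Set.powersetCard])
    (fun s : Finset (Fin N) => ∏ j ∈ s, μ j)).symm

/-- In a weight basis, `char (t ^ i)` is the `i`-th power sum of the weights at `t`, so Newton's
formulas return their elementary symmetric functions, which are the traces on the exterior powers.
-/
theorem RationalRep.extChar_eq {X : ClassicalType} {n : ℕ} (M : RationalRep X n) (k : ℕ) :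
    M.extChar k = PowerSeries.coeff k (lamFun M.char) := by
  obtain ⟨N, b, w, hw⟩ := M.exists_weightBasis
  funext t
  have h : (fun i => M.char (t ^ i)) = fun i : ℕ => ∑ j, torusChar (w j) t ^ i := by
    funext i
    rw [RationalRep.char, trace_eq_sum_of_eigenbasis b _ _ (hw (t ^ i))]
    simp
  rw [coeff_lamFun, h, newtonCoeff_powerSum']
  exact trace_exteriorPower_map b _ _ (hw t) k

/-- Laurent polynomial functions with integral coefficients, as a subring. -/
def intLaurentRing (n : ℕ) : Subring (TorusFun n) :=
  Subring.closure (Set.range fun m : Fin n → ℤ => (⇑(torusChar m) : TorusFun n))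

theorem RationalRep.char_mem_intLaurentRing {X : ClassicalType} {n : ℕ} (M : RationalRep X n) :
    M.char ∈ intLaurentRing n := by
  obtain ⟨N, b, w, hw⟩ := M.exists_weightBasis
  have h : M.char = ∑ j, (⇑(torusChar (w j)) : TorusFun n) := by
    funext t
    rw [RationalRep.char, trace_eq_sum_of_eigenbasis b _ _ (hw t), Finset.sum_apply]
  rw [h]
  exact Subring.sum_mem _ fun j _ => Subring.subset_closure ⟨w j, rfl⟩

theorem repRing_le_intLaurentRing (X : ClassicalType) (n : ℕ) : repRing X n ≤ intLaurentRing n := by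
  refine Subring.closure_le.2 ?_
  rintro _ ⟨M, rfl⟩
  exact M.char_mem_intLaurentRing

/-- The characters are closed under multiplication, so the ring they generate is their `ℤ`-span. -/
theorem exists_int_expansion {n : ℕ} {f : TorusFun n} (hf : f ∈ intLaurentRing n) :
    ∃ c : (Fin n → ℤ) →₀ ℤ, f = c.sum fun m a => (a : ℂ) • (⇑(torusChar m) : TorusFun n) := by
  rw [intLaurentRing, Subring.mem_closure_iff] at hf
  have hmon : (Submonoid.closure (Set.range fun m : Fin n → ℤ => (⇑(torusChar m) : TorusFun n)) :
      Set (TorusFun n)) ⊆ Set.range fun m : Fin n → ℤ => (⇑(torusChar m) : TorusFun n) := by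
    intro x hx
    induction hx using Submonoid.closure_induction with
    | mem x hx => exact hx
    | one => exact ⟨0, torusChar_zero⟩
    | mul x y _ _ hx hy =>
      obtain ⟨m, rfl⟩ := hx
      obtain ⟨m', rfl⟩ := hy
      exact ⟨m + m', torusChar_add m m'⟩
  have hadd : ∀ c d : (Fin n → ℤ) →₀ ℤ,
      (c + d).sum (fun m a => (a : ℂ) • (⇑(torusChar m) : TorusFun n)) =
        c.sum (fun m a => (a : ℂ) • (⇑(torusChar m) : TorusFun n)) +
        d.sum fun m a => (a : ℂ) • (⇑(torusChar m) : TorusFun n) := fun c d =>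
    Finsupp.sum_add_index' (by simp) (by simp [add_smul])
  induction hf using AddSubgroup.closure_induction with
  | mem x hx =>
    obtain ⟨m, rfl⟩ := hmon hx
    exact ⟨Finsupp.single m 1, by simp⟩
  | zero => exact ⟨0, by simp⟩
  | add x y _ _ hx hy =>
    obtain ⟨c, rfl⟩ := hx
    obtain ⟨d, rfl⟩ := hy
    exact ⟨c + d, (hadd c d).symm⟩
  | neg x _ hx =>
    obtain ⟨c, rfl⟩ := hx
    refine ⟨-c, ?_⟩
    have := hadd c (-c)
    rw [add_neg_cancel, Finsupp.sum_zero_index] at this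
    exact neg_eq_of_add_eq_zero_right this.symm

/-! ### Constructions of rational representations -/

/-- Polynomial functions on the group. -/
def regularFun (X : ClassicalType) (n : ℕ) : Subalgebra ℂ (classicalGroup X n → ℂ) :=
  (MvPolynomial.aeval fun (ij : Fin (dim X n) × Fin (dim X n)) (g : classicalGroup X n) =>
    toMat g ij.1 ij.2).range

theorem mem_regularFun {X : ClassicalType} {n : ℕ} {f : classicalGroup X n → ℂ} :
    f ∈ regularFun X n ↔ ∃ p : MvPolynomial (Fin (dim X n) × Fin (dim X n)) ℂ, ∀ g,
      f g = MvPolynomial.eval (fun ij => toMat g ij.1 ij.2) p := by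
  have h : ∀ (p : MvPolynomial (Fin (dim X n) × Fin (dim X n)) ℂ) g,
      MvPolynomial.aeval (fun (ij : Fin (dim X n) × Fin (dim X n)) (g : classicalGroup X n) =>
        toMat g ij.1 ij.2) p g = MvPolynomial.eval (fun ij => toMat g ij.1 ij.2) p := by
    intro p g
    have := MvPolynomial.comp_aeval_apply
      (f := fun (ij : Fin (dim X n) × Fin (dim X n)) (g : classicalGroup X n) =>
        toMat g ij.1 ij.2) (Pi.evalAlgHom ℂ (fun _ : classicalGroup X n => ℂ) g) p
    exact this
  rw [regularFun, AlgHom.mem_range]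
  constructor
  · rintro ⟨p, rfl⟩
    exact ⟨p, h p⟩
  · rintro ⟨p, hp⟩
    exact ⟨p, funext fun g => by rw [h, hp]⟩

theorem toMat_mul {X : ClassicalType} {n : ℕ} (g h : classicalGroup X n) :
    toMat (g * h) = toMat g * toMat h := rfl

theorem toMat_one {X : ClassicalType} {n : ℕ} :
    toMat (1 : classicalGroup X n) = 1 := rfl

theorem RationalRep.coord_mem {X : ClassicalType} {n : ℕ} (M : RationalRep X n) (v : M.V)
    (φ : Module.Dual ℂ M.V) : (fun g => φ (M.ρ g v)) ∈ regularFun X n :=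
  mem_regularFun.2 (M.rational v φ)

/-- The standard representation. -/
def stdRep (X : ClassicalType) (n : ℕ) : RationalRep X n where
  V := Fin (dim X n) → ℂ
  ρ :=
    { toFun := fun g => Matrix.mulVecLin (toMat g)
      map_one' := by rw [toMat_one, Matrix.mulVecLin_one]; rfl
      map_mul' := fun g h => by rw [toMat_mul, Matrix.mulVecLin_mul]; rfl }
  rational v φ := by
    refine mem_regularFun.1 ?_
    have h : (fun g : classicalGroup X n => φ (Matrix.mulVecLin (toMat g) v)) =
        ∑ i, ∑ j, (φ (Pi.single i 1) * v j) • fun g : classicalGroup X n => toMat g i j := by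
      funext g
      rw [Matrix.mulVecLin_apply, pi_eq_sum_univ' (toMat g *ᵥ v), map_sum, Finset.sum_apply]
      refine Finset.sum_congr rfl fun i _ => ?_
      rw [map_smul, Finset.sum_apply, Matrix.mulVec, dotProduct, smul_eq_mul, Finset.sum_mul]
      refine Finset.sum_congr rfl fun j _ => ?_
      rw [Pi.smul_apply, smul_eq_mul]
      ring
    refine (congrArg (· ∈ regularFun X n) h).mpr ?_
    refine Subalgebra.sum_mem _ fun i _ => Subalgebra.sum_mem _ fun j _ =>
      Subalgebra.smul_mem _ ?_ _
    exact mem_regularFun.2 ⟨MvPolynomial.X (i, j), fun g => by simp⟩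

theorem stdRep_char (X : ClassicalType) (n : ℕ) :
    (stdRep X n).char = fun t => ∑ i, (torusEntry X t i : ℂ) := by
  funext t
  change LinearMap.trace ℂ (Fin (dim X n) → ℂ)
    (Matrix.toLin' (Matrix.diagonal fun i => (torusEntry X t i : ℂ))) = _
  rw [Matrix.trace_toLin'_eq, Matrix.trace_diagonal]

/-- The one-dimensional trivial representation. -/
def trivialRep (X : ClassicalType) (n : ℕ) : RationalRep X n where
  V := ℂ
  ρ := Representation.trivial ℂ (classicalGroup X n) ℂ
  rational v φ := ⟨MvPolynomial.C (φ v), fun g => by simp⟩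

theorem trivialRep_char (X : ClassicalType) (n : ℕ) : (trivialRep X n).char = 1 := by
  funext t
  change LinearMap.trace ℂ ℂ (1 : ℂ →ₗ[ℂ] ℂ) = 1
  rw [LinearMap.trace_one]
  simp

/-- The tensor product of two rational representations. -/
def tensorRep {X : ClassicalType} {n : ℕ} (M N : RationalRep X n) : RationalRep X n where
  V := TensorProduct ℂ M.V N.V
  ρ := M.ρ.tprod N.ρ
  rational v φ := by
    refine mem_regularFun.1 ?_
    induction v using TensorProduct.induction_on with
    | zero =>
      simp only [map_zero]
      exact (regularFun X n).zero_mem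
    | add x y hx hy =>
      simp only [map_add]
      exact (regularFun X n).add_mem hx hy
    | tmul x y =>
      let b := Module.finBasis ℂ M.V
      let c := Module.finBasis ℂ N.V
      have h : (fun g : classicalGroup X n => φ (M.ρ.tprod N.ρ g (x ⊗ₜ[ℂ] y))) =
          ∑ i, ∑ j, (φ (b i ⊗ₜ[ℂ] c j)) • ((fun g : classicalGroup X n => b.coord i (M.ρ g x)) *
            fun g : classicalGroup X n => c.coord j (N.ρ g y)) := by
        funext g
        rw [Representation.tprod_apply, TensorProduct.map_tmul, ← b.sum_repr (M.ρ g x),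
          ← c.sum_repr (N.ρ g y), TensorProduct.sum_tmul, map_sum, Finset.sum_apply]
        refine Finset.sum_congr rfl fun i _ => ?_
        rw [TensorProduct.tmul_sum, map_sum, Finset.sum_apply]
        refine Finset.sum_congr rfl fun j _ => ?_
        rw [TensorProduct.smul_tmul_smul, map_smul]
        simp only [smul_eq_mul, Pi.smul_apply, Pi.mul_apply, Module.Basis.coord_apply]
        ring
      refine (congrArg (· ∈ regularFun X n) h).mpr ?_
      exact Subalgebra.sum_mem _ fun i _ => Subalgebra.sum_mem _ fun j _ =>
        Subalgebra.smul_mem _ (Subalgebra.mul_mem _ (M.coord_mem _ _) (N.coord_mem _ _)) _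

theorem tensorRep_char {X : ClassicalType} {n : ℕ} (M N : RationalRep X n) :
    (tensorRep M N).char = M.char * N.char := by
  funext t
  exact LinearMap.trace_tensorProduct' (M.ρ (torusHom X n t)) (N.ρ (torusHom X n t))

/-- The exterior powers of a rational representation. -/
def exteriorRep {X : ClassicalType} {n : ℕ} (M : RationalRep X n) (k : ℕ) : RationalRep X n where
  V := ⋀[ℂ]^k M.V
  ρ :=
    { toFun := fun g => exteriorPower.map k (M.ρ g)
      map_one' := by rw [map_one]; exact exteriorPower.map_id
      map_mul' := fun g h => by rw [map_mul]; exact exteriorPower.map_comp _ _ }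
  rational v φ := by
    refine mem_regularFun.1 ?_
    have hv : v ∈ Submodule.span ℂ (Set.range (exteriorPower.ιMulti ℂ k (M := M.V))) := by
      rw [exteriorPower.ιMulti_span]; exact Submodule.mem_top
    change (fun g => φ (exteriorPower.map k (M.ρ g) v)) ∈ regularFun X n
    induction hv using Submodule.span_induction with
    | zero =>
      simp only [map_zero]
      exact (regularFun X n).zero_mem
    | add x y _ _ hx hy =>
      simp only [map_add]
      exact (regularFun X n).add_mem hx hy
    | smul a x _ hx =>
      simp only [map_smul]
      exact (regularFun X n).smul_mem hx a
    | mem x hx =>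
      obtain ⟨w, rfl⟩ := hx
      let b := Module.finBasis ℂ M.V
      -- Multilinear expansion of every `ρ(g) (w j)` in the basis exhibits the coefficient as a
      -- polynomial in matrix coefficients of `M`.
      have h : (fun g => φ (exteriorPower.map k (M.ρ g) (exteriorPower.ιMulti ℂ k w))) =
          ∑ r : Fin k → Fin (Module.finrank ℂ M.V),
            φ (exteriorPower.ιMulti ℂ k fun j => b (r j)) •
              ∏ j, fun g : classicalGroup X n => b.coord (r j) (M.ρ g (w j)) := by
        funext g
        rw [exteriorPower.map_apply_ιMulti, Finset.sum_apply]
        have h1 : (M.ρ g ∘ w) = fun j => ∑ i, b.repr (M.ρ g (w j)) i • b i :=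
          funext fun j => (b.sum_repr _).symm
        rw [h1, ← AlternatingMap.coe_multilinearMap, MultilinearMap.map_sum, map_sum]
        refine Finset.sum_congr rfl fun r _ => ?_
        rw [MultilinearMap.map_smul_univ, map_smul, Pi.smul_apply, Finset.prod_apply]
        simp only [smul_eq_mul, Module.Basis.coord_apply, AlternatingMap.coe_multilinearMap]
        ring
      rw [h]
      exact Subalgebra.sum_mem _ fun r _ =>
        Subalgebra.smul_mem _ (Subalgebra.prod_mem _ fun j _ => M.coord_mem _ _) _

theorem exteriorRep_char {X : ClassicalType} {n : ℕ} (M : RationalRep X n) (k : ℕ) :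
    (exteriorRep M k).char = M.extChar k := rfl

/-! ### The lambda-structure of the representation ring -/

theorem coeff_lamFun_mem_repRing {X : ClassicalType} {n : ℕ} {x : TorusFun n}
    (hx : x ∈ repRing X n) (k : ℕ) : PowerSeries.coeff k (lamFun x) ∈ repRing X n := by
  refine coeff_mem_of_mem_closure isSpecialLambdaRing_lamFun ?_ hx k
  rintro _ ⟨M, rfl⟩ k
  rw [← M.extChar_eq, ← exteriorRep_char]
  exact (exteriorRep M k).toRepRing.2

/-- The lambda-operation of the representation ring. -/
def lamRep (X : ClassicalType) (n : ℕ) (x : repRing X n) : PowerSeries (repRing X n) :=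
  PowerSeries.mk fun k => ⟨PowerSeries.coeff k (lamFun (x : TorusFun n)),
    coeff_lamFun_mem_repRing x.2 k⟩

theorem coe_coeff_lamRep {X : ClassicalType} {n : ℕ} (x : repRing X n) (k : ℕ) :
    ((PowerSeries.coeff k (lamRep X n x) : repRing X n) : TorusFun n) =
      PowerSeries.coeff k (lamFun (x : TorusFun n)) := by
  rw [lamRep, PowerSeries.coeff_mk]

theorem isSpecialLambdaRing_lamRep (X : ClassicalType) (n : ℕ) :
    IsSpecialLambdaRing (lamRep X n) :=
  isSpecialLambdaRing_of_injective (f := (repRing X n).subtype) Subtype.val_injective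
    isSpecialLambdaRing_lamFun fun x k => coe_coeff_lamRep x k

theorem isExteriorLambda_lamRep (X : ClassicalType) (n : ℕ) : IsExteriorLambda (lamRep X n) where
  map_add := (isSpecialLambdaRing_lamRep X n).map_add
  rep M i := by
    rw [coe_coeff_lamRep, M.extChar_eq]
    rfl

/-- The representation ring is additively generated by the characters of representations. -/
theorem mem_closure_toRepRing {X : ClassicalType} {n : ℕ} (x : repRing X n) :
    x ∈ AddSubgroup.closure (Set.range fun M : RationalRep X n => M.toRepRing) := by
  obtain ⟨x, hx⟩ := x
  have hx' := hx
  rw [repRing, Subring.mem_closure_iff] at hx'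
  have hmon : (Submonoid.closure (Set.range fun M : RationalRep X n => M.char) :
      Set (TorusFun n)) ⊆ Set.range fun M : RationalRep X n => M.char := by
    intro x hx
    induction hx using Submonoid.closure_induction with
    | mem x hx => exact hx
    | one => exact ⟨trivialRep X n, trivialRep_char X n⟩
    | mul x y _ _ hx hy =>
      obtain ⟨M, rfl⟩ := hx
      obtain ⟨N, rfl⟩ := hy
      exact ⟨tensorRep M N, tensorRep_char M N⟩
  have hle : AddSubgroup.closure (Submonoid.closure (Set.range fun M : RationalRep X n => M.char) :
      Set (TorusFun n)) ≤ (AddSubgroup.closure (Set.range fun M : RationalRep X n =>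
        M.toRepRing)).map (repRing X n).subtype.toAddMonoidHom := by
    refine (AddSubgroup.closure_le _).2 fun y hy => ?_
    obtain ⟨M, rfl⟩ := hmon hy
    exact ⟨M.toRepRing, AddSubgroup.subset_closure ⟨M, rfl⟩, rfl⟩
  obtain ⟨y, hy, e⟩ := hle hx'
  have : y = ⟨x, hx⟩ := Subtype.ext e
  rwa [← this]

/-- Both operations turn sums into products and agree on an additive generating set. The values at
`0` and at negatives follow by cancelling series with constant term `1`; only `lamRep` is known to
have such values beforehand. -/
theorem eq_lamRep {X : ClassicalType} {n : ℕ} {lam : repRing X n → PowerSeries (repRing X n)}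
    (h : IsExteriorLambda lam) : lam = lamRep X n := by
  have hs := isSpecialLambdaRing_lamRep X n
  have hu : ∀ x, IsUnit (lamRep X n x) := by
    intro x
    rw [PowerSeries.isUnit_iff_constantCoeff, ← PowerSeries.coeff_zero_eq_constantCoeff_apply,
      hs.coeff_zero]
    exact isUnit_one
  have hM : ∀ M : RationalRep X n, lam M.toRepRing = lamRep X n M.toRepRing := by
    intro M
    ext1 i
    apply Subtype.ext
    rw [h.rep, (isExteriorLambda_lamRep X n).rep]
  have h0 : lam 0 = lamRep X n 0 := by
    have h1 := h.map_add (trivialRep X n).toRepRing 0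
    have h2 := hs.map_add (trivialRep X n).toRepRing 0
    rw [add_zero, hM] at h1
    rw [add_zero] at h2
    exact (hu _).mul_left_cancel (h1.symm.trans h2)
  funext x
  induction mem_closure_toRepRing x using AddSubgroup.closure_induction with
  | mem x hx =>
    obtain ⟨M, rfl⟩ := hx
    exact hM M
  | zero => exact h0
  | add x y _ _ hx hy => rw [h.map_add, hs.map_add, hx, hy]
  | neg x _ hx =>
    have h1 := h.map_add x (-x)
    have h2 := hs.map_add x (-x)
    rw [add_neg_cancel, hx] at h1
    rw [add_neg_cancel, ← h0, h1] at h2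
    exact (hu _).mul_left_cancel h2

/-! ### The Springer morphism on the torus -/

/-- The number of middle diagonal entries. -/
def midCount : ClassicalType → ℕ
  | .B => 1
  | .C => 0

theorem two_mul_le_dim (X : ClassicalType) (n : ℕ) : 2 * n ≤ dim X n := by
  cases X <;> simp [dim]

/-- Each of the first `n` indices is paired with its mirror image. In type `B` one fixed index
remains, and `a` is the value there. -/
theorem sum_fin_dim {A : Type*} [AddCommMonoid A] (X : ClassicalType) {n : ℕ}
    (f : Fin (dim X n) → A) (a : A) (ha : ∀ i, i.rev = i → f i = a) :
    ∑ i, f i = ∑ i : Fin n, (f (Fin.castLE (le_dim X n) i) + f (Fin.castLE (le_dim X n) i).rev) +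
      midCount X • a := by
  cases X with
  | C =>
    have e : n + n = dim .C n := by simp only [dim]; omega
    rw [← (finCongr e).sum_comp, Fin.sum_univ_add, Finset.sum_add_distrib,
      ← Equiv.sum_comp Fin.revPerm (fun i => f ((finCongr e) (Fin.natAdd n i)))]
    simp only [midCount, zero_smul, add_zero]
    congr 1
    refine Finset.sum_congr rfl fun i _ => congrArg f (Fin.ext ?_)
    simp [← e]
    omega
  | B =>
    have e : (n + 1) + n = dim .B n := by simp only [dim]; omega
    rw [← (finCongr e).sum_comp, Fin.sum_univ_add, Fin.sum_univ_castSucc, Finset.sum_add_distrib,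
      ← Equiv.sum_comp Fin.revPerm (fun i => f ((finCongr e) (Fin.natAdd (n + 1) i)))]
    rw [ha ((finCongr e) (Fin.castAdd n (Fin.last n)))]
    · simp only [midCount, one_smul]
      rw [add_right_comm]
      congr 2
      refine Finset.sum_congr rfl fun i _ => congrArg f (Fin.ext ?_)
      simp [← e]
      omega
    · apply Fin.ext
      simp [← e]

/-- The diagonal entries of `torusLie X x`. -/
def lieEntry (X : ClassicalType) {n : ℕ} (x : Fin n → ℂ) (i : Fin (dim X n)) : ℂ :=
  if h : (i : ℕ) < n then x ⟨i, h⟩ else if h' : (i.rev : ℕ) < n then -x ⟨i.rev, h'⟩ else 0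

theorem torusLie_eq (X : ClassicalType) {n : ℕ} (x : Fin n → ℂ) :
    torusLie X x = Matrix.diagonal (lieEntry X x) := rfl

theorem lieEntry_castLE (X : ClassicalType) {n : ℕ} (x : Fin n → ℂ) (i : Fin n) :
    lieEntry X x (Fin.castLE (le_dim X n) i) = x i := by
  simp [lieEntry]

theorem torusEntry_castLE (X : ClassicalType) {n : ℕ} (t : Fin n → ℂˣ) (i : Fin n) :
    torusEntry X t (Fin.castLE (le_dim X n) i) = t i := by
  simp [torusEntry]

theorem lieEntry_rev (X : ClassicalType) {n : ℕ} (x : Fin n → ℂ) (i : Fin (dim X n)) :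
    lieEntry X x i.rev = -lieEntry X x i := by
  have hi := i.2
  have hr : (i.rev : ℕ) = dim X n - (i + 1) := Fin.val_rev i
  have hd := two_mul_le_dim X n
  unfold lieEntry
  by_cases h1 : (i : ℕ) < n
  · have h2 : ¬ (i.rev : ℕ) < n := by omega
    simp [h1, h2, -Fin.val_rev]
  · by_cases h2 : (i.rev : ℕ) < n
    · simp [h1, h2, -Fin.val_rev]
    · simp [h1, h2, -Fin.val_rev]

theorem torusEntry_rev (X : ClassicalType) {n : ℕ} (t : Fin n → ℂˣ) (i : Fin (dim X n)) :
    torusEntry X t i.rev = (torusEntry X t i)⁻¹ :=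
  eq_inv_of_mul_eq_one_right (torusEntry_mul_rev X t i)

theorem eq_castLE_or_rev (X : ClassicalType) {n : ℕ} (i : Fin (dim X n)) :
    (∃ j : Fin n, i = Fin.castLE (le_dim X n) j) ∨
      (∃ j : Fin n, i = (Fin.castLE (le_dim X n) j).rev) ∨ i.rev = i := by
  have hi := i.2
  have hr : (i.rev : ℕ) = dim X n - (i + 1) := Fin.val_rev i
  by_cases h1 : (i : ℕ) < n
  · exact Or.inl ⟨⟨i, h1⟩, rfl⟩
  · by_cases h2 : (i.rev : ℕ) < n
    · refine Or.inr (Or.inl ⟨⟨i.rev, h2⟩, ?_⟩)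
      apply Fin.rev_injective
      rw [Fin.rev_rev]
      rfl
    · refine Or.inr (Or.inr (Fin.ext ?_))
      have hd : dim X n = 2 * n ∨ dim X n = 2 * n + 1 := by cases X <;> simp [dim]
      omega

theorem eq_lieEntry (X : ClassicalType) {n : ℕ} {d : Fin (dim X n) → ℂ}
    (hd : ∀ i, d i.rev = -d i) : d = lieEntry X fun i => d (Fin.castLE (le_dim X n) i) := by
  funext i
  rcases eq_castLE_or_rev X i with ⟨j, rfl⟩ | ⟨j, rfl⟩ | h
  · rw [lieEntry_castLE]
  · rw [lieEntry_rev, lieEntry_castLE, hd]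
  · have h1 := hd i
    have h2 := lieEntry_rev X (fun i => d (Fin.castLE (le_dim X n) i)) i
    rw [h, self_eq_neg] at h1 h2
    rw [h1, h2]

/-- The second hypothesis is needed in type `B`: at the middle index the first one gives only `s i =
± 1`. -/
theorem eq_torusEntry (X : ClassicalType) {n : ℕ} {s : Fin (dim X n) → ℂˣ}
    (hs : ∀ i, s i.rev = (s i)⁻¹) (hm : ∀ i, i.rev = i → s i = 1) :
    s = torusEntry X fun i => s (Fin.castLE (le_dim X n) i) := by
  funext i
  rcases eq_castLE_or_rev X i with ⟨j, rfl⟩ | ⟨j, rfl⟩ | h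
  · rw [torusEntry_castLE]
  · rw [torusEntry_rev, torusEntry_castLE, hs]
  · rw [hm i h, torusEntry_of_rev_eq X _ i h]

theorem antidiagEntry_ne_zero (X : ClassicalType) (n i : ℕ) : antidiagEntry X n i ≠ 0 := by
  cases X <;> simp only [antidiagEntry] <;> split_ifs <;> norm_num

theorem mem_lieAlg {X : ClassicalType} {n : ℕ} {A : Matrix (Fin (dim X n)) (Fin (dim X n)) ℂ} :
    A ∈ lieAlg X n ↔ Aᵀ * formMatrix X n = formMatrix X n * (-A) :=
  mem_skewAdjointMatricesSubmodule _ _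

theorem formMatrix_mul_apply {X : ClassicalType} {n : ℕ}
    (A : Matrix (Fin (dim X n)) (Fin (dim X n)) ℂ) (i j : Fin (dim X n)) :
    (formMatrix X n * A) i j = antidiagEntry X n i * A i.rev j := by
  rw [Matrix.mul_apply, Finset.sum_eq_single i.rev]
  · simp [formMatrix]
  · intro k _ hk
    simp [formMatrix, hk]
  · intro h
    exact absurd (Finset.mem_univ _) h

theorem mul_formMatrix_apply {X : ClassicalType} {n : ℕ}
    (A : Matrix (Fin (dim X n)) (Fin (dim X n)) ℂ) (i j : Fin (dim X n)) :
    (A * formMatrix X n) i j = A i j.rev * antidiagEntry X n j.rev := by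
  rw [Matrix.mul_apply, Finset.sum_eq_single j.rev]
  · simp [formMatrix]
  · intro k _ hk
    have : ¬ j = k.rev := fun h => hk (by rw [h, Fin.rev_rev])
    simp [formMatrix, this]
  · intro h
    exact absurd (Finset.mem_univ _) h

theorem apply_rev_of_mem_lieAlg {X : ClassicalType} {n : ℕ}
    {A : Matrix (Fin (dim X n)) (Fin (dim X n)) ℂ} (hA : A ∈ lieAlg X n) (i : Fin (dim X n)) :
    A i.rev i.rev = -A i i := by
  have h := congrFun (congrFun (mem_lieAlg.1 hA) i) i.rev
  rw [formMatrix_mul_apply, mul_formMatrix_apply, Fin.rev_rev, Matrix.transpose_apply,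
    Matrix.neg_apply, mul_comm] at h
  rw [mul_left_cancel₀ (antidiagEntry_ne_zero X n i) h, neg_neg]

theorem diagonal_mem_lieAlg {X : ClassicalType} {n : ℕ} {d : Fin (dim X n) → ℂ}
    (hd : ∀ i, d i.rev = -d i) : Matrix.diagonal d ∈ lieAlg X n := by
  rw [mem_lieAlg]
  ext i j
  rw [formMatrix_mul_apply, mul_formMatrix_apply, Matrix.diagonal_transpose, Matrix.neg_apply]
  by_cases h : j = i.rev
  · subst h
    simp [hd, -Fin.val_rev, mul_comm]
  · have h1 : i ≠ j.rev := fun e => h (by rw [e, Fin.rev_rev])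
    have h2 : i.rev ≠ j := fun e => h e.symm
    simp [h1, h2]

theorem torusLie_mem_lieAlg (X : ClassicalType) {n : ℕ} (x : Fin n → ℂ) :
    torusLie X x ∈ lieAlg X n :=
  diagonal_mem_lieAlg (lieEntry_rev X x)

theorem diagonal_mem_lieAlgPerp {X : ClassicalType} {n : ℕ} {d : Fin (dim X n) → ℂ}
    (hd : ∀ i, d i.rev = d i) : Matrix.diagonal d ∈ lieAlgPerp X n := by
  intro B hB
  have h : (Matrix.diagonal d * B).trace = ∑ i, d i * B i i := by
    simp [Matrix.trace, Matrix.diagonal_mul]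
  have h2 : ∑ i, d i * B i i = -∑ i, d i * B i i := by
    conv_lhs => rw [← Equiv.sum_comp Fin.revPerm]
    simp only [Fin.revPerm_apply, hd, apply_rev_of_mem_lieAlg hB, mul_neg, Finset.sum_neg_distrib]
  rw [h]
  exact self_eq_neg.1 h2

/-- Reversal of the indices inverts the diagonal entries. The part `(t - t⁻¹) / 2` is odd under
reversal and lies in `𝔤`; the part `(t + t⁻¹) / 2` is even and lies in `𝔤^⊥`. -/
theorem springer_torusHom (X : ClassicalType) (n : ℕ) (t : Fin n → ℂˣ) :
    springer X n (torusHom X n t) = torusLie X fun i => ((t i : ℂ) - (t i : ℂ)⁻¹) / 2 := by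
  let d : Fin (dim X n) → ℂ := fun i =>
    ((torusEntry X t i : ℂ) - ((torusEntry X t i)⁻¹ : ℂˣ)) / 2
  let s : Fin (dim X n) → ℂ := fun i =>
    ((torusEntry X t i : ℂ) + ((torusEntry X t i)⁻¹ : ℂˣ)) / 2
  have hd : ∀ i, d i.rev = -d i := by
    intro i
    simp only [d, torusEntry_rev, inv_inv]
    ring
  have hs : ∀ i, s i.rev = s i := by
    intro i
    simp only [s, torusEntry_rev, inv_inv]
    ring
  have h1 : toMat (torusHom X n t) = Matrix.diagonal d + Matrix.diagonal s := by
    rw [Matrix.diagonal_add]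
    change Matrix.diagonal (fun i => (torusEntry X t i : ℂ)) = _
    congr 1
    funext i
    simp only [d, s]
    ring
  have h2 : Matrix.diagonal d = torusLie X fun i => ((t i : ℂ) - (t i : ℂ)⁻¹) / 2 := by
    rw [torusLie_eq, eq_lieEntry X hd]
    simp [d, torusEntry_castLE]
  rw [springer, h1, map_add, h2]
  have e1 := Submodule.projection_apply_left (isCompl_lieAlg X n)
    ⟨_, torusLie_mem_lieAlg X fun i => ((t i : ℂ) - (t i : ℂ)⁻¹) / 2⟩
  have e2 := (Submodule.projection_apply_eq_zero_iff (isCompl_lieAlg X n)).2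
    (diagonal_mem_lieAlgPerp hs)
  rw [e1, e2, add_zero]

theorem springerPullback_apply (X : ClassicalType) (n : ℕ) (p : MvPolynomial (Fin n) ℂ)
    (t : Fin n → ℂˣ) : springerPullback X n p t =
      MvPolynomial.eval (fun i => ((t i : ℂ) - (t i : ℂ)⁻¹) / 2) p := by
  change MvPolynomial.aeval (lieCoord X n (springer X n (torusHom X n t))) p = _
  rw [springer_torusHom, lieCoord_torusLie]
  exact DFunLike.congr_fun (MvPolynomial.coe_aeval_eq_eval _) p

/-! ### The character `chi` -/

theorem chi_mem_repRing (X : ClassicalType) (n : ℕ) : chi n ∈ repRing X n := by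
  let v : TorusFun n := (stdRep X n).char
  have hv : v ∈ repRing X n := (stdRep X n).toRepRing.2
  have hsum : ∀ t, v t = ∑ i, ((t i : ℂ) + (t i : ℂ)⁻¹) + midCount X := by
    intro t
    simp only [v, stdRep_char]
    rw [sum_fin_dim X _ 1 fun i hi => by rw [torusEntry_of_rev_eq X t i hi, Units.val_one]]
    simp [torusEntry_castLE, torusEntry_rev]
  -- Newton's identity `p_2 = e_1 ^ 2 - 2 e_2` for the weights of the standard representation. The
  -- second Adams operation on `v` gives `χ`, plus `1` from the zero weight in type `B`.
  have h : chi n = v * v - 2 * PowerSeries.coeff 2 (lamFun v) - (midCount X : TorusFun n) := by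
    funext t
    have h1 := newtonCoeff_succ (fun i => v (t ^ i)) 1
    have h2 := newtonCoeff_succ (fun i => v (t ^ i)) 0
    simp only [Finset.sum_range_succ, Finset.sum_range_zero, newtonCoeff_zero] at h1 h2
    norm_num at h1 h2
    rw [h2] at h1
    simp only [Pi.sub_apply, Pi.mul_apply, coeff_lamFun]
    have h3 : v (t ^ 2) = chi n t + midCount X := by
      rw [hsum, chi]
      simp [zpow_neg]
    have h4 : (midCount X : TorusFun n) t = midCount X := rfl
    have h5 : (2 : TorusFun n) t = 2 := rfl
    rw [h4, h5]
    linear_combination h1 - h3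
  rw [h]
  refine Subring.sub_mem _ (Subring.sub_mem _ (Subring.mul_mem _ hv hv) (Subring.mul_mem _ ?_
    (coeff_lamFun_mem_repRing hv 2))) (natCast_mem _ _)
  exact_mod_cast natCast_mem (repRing X n) 2

/-! ### The action of the normalizer of the torus -/

theorem toMat_torusHom (X : ClassicalType) {n : ℕ} (t : Fin n → ℂˣ) :
    toMat (torusHom X n t) = Matrix.diagonal fun i => (torusEntry X t i : ℂ) := rfl

theorem toMat_torusHom_sub (X : ClassicalType) {n : ℕ} (t : Fin n → ℂˣ) :
    toMat (torusHom X n t) - toMat (torusHom X n t⁻¹) =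
      torusLie X fun i => (t i : ℂ) - (t i : ℂ)⁻¹ := by
  rw [toMat_torusHom, toMat_torusHom, Matrix.diagonal_sub, torusLie_eq,
    eq_lieEntry X (d := fun i => (torusEntry X t i : ℂ) - (torusEntry X t⁻¹ i : ℂ))]
  · simp [torusEntry_castLE]
  · intro i
    have h : ∀ i, torusEntry X t⁻¹ i = (torusEntry X t i)⁻¹ := by
      intro i
      unfold torusEntry
      split_ifs <;> simp
    simp only [h, torusEntry_rev, inv_inv]
    ring

theorem exists_sub_inv_eq (x : ℂ) : ∃ t : ℂˣ, (t : ℂ) - (t : ℂ)⁻¹ = x := by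
  -- The equation is `t ^ 2 - x t - 1 = 0`, with discriminant `x ^ 2 + 4`; `t = (x + s) / 2` has
  -- inverse `(s - x) / 2`.
  obtain ⟨s, hs⟩ := IsAlgClosed.exists_pow_nat_eq (x ^ 2 + 4) (n := 2) (by norm_num)
  have h : ((x + s) / 2) * ((s - x) / 2) = 1 := by linear_combination hs / 4
  refine ⟨Units.mkOfMulEqOne _ _ h, ?_⟩
  rw [Units.val_mkOfMulEqOne, inv_eq_of_mul_eq_one_right h]
  ring

/-- Every element of `𝔱` has the form `t - t⁻¹` with `t` in the torus, so the action of the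
normalizer on `T` determines its action on `𝔱` without differentiation. -/
theorem exists_conj_torusLie_eq {X : ClassicalType} {n : ℕ} {g : classicalGroup X n}
    (hg : g ∈ Subgroup.normalizer (torus X n : Set (classicalGroup X n))) (x : Fin n → ℂ) :
    ∃ x' : Fin n → ℂ, toMat g * torusLie X x * toMat g⁻¹ = torusLie X x' := by
  choose t ht using fun i => exists_sub_inv_eq (x i)
  have hx : torusLie X x = toMat (torusHom X n t) - toMat (torusHom X n t⁻¹) := by
    rw [toMat_torusHom_sub]
    congr 1
    funext i
    exact (ht i).symm
  obtain ⟨s, hs⟩ := (Subgroup.mem_normalizer_iff.1 hg (torusHom X n t)).1 ⟨t, rfl⟩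
  refine ⟨fun i => (s i : ℂ) - (s i : ℂ)⁻¹, ?_⟩
  rw [← toMat_torusHom_sub, hx, Matrix.mul_sub, Matrix.sub_mul, ← toMat_mul, ← toMat_mul,
    ← toMat_mul, ← toMat_mul, map_inv, map_inv, hs]
  congr 2
  group

/-- The entries `x_i` and `-x_i` contribute equally, whence the factor `2`; the middle entry `0` of
type `B` contributes `2 ^ j`. -/
theorem trace_torusLie_pow (X : ClassicalType) {n : ℕ} (x : Fin n → ℂ) (j : ℕ) :
    ((4 * torusLie X x ^ 2 + 2) ^ j).trace =
      2 * ∑ i, (4 * x i ^ 2 + 2) ^ j + (midCount X : ℂ) * 2 ^ j := by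
  have h : (4 * torusLie X x ^ 2 + 2) ^ j =
      Matrix.diagonal fun i => (4 * lieEntry X x i ^ 2 + 2) ^ j := by
    have h4 : (4 : Matrix (Fin (dim X n)) (Fin (dim X n)) ℂ) = Matrix.diagonal fun _ => 4 := by
      rw [← Matrix.diagonal_ofNat']; rfl
    have h2 : (2 : Matrix (Fin (dim X n)) (Fin (dim X n)) ℂ) = Matrix.diagonal fun _ => 2 := by
      rw [← Matrix.diagonal_ofNat']; rfl
    rw [torusLie_eq, Matrix.diagonal_pow, h4, Matrix.diagonal_mul_diagonal, h2, Matrix.diagonal_add,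
      Matrix.diagonal_pow]
    rfl
  rw [h, Matrix.trace_diagonal, sum_fin_dim X _ (2 ^ j)]
  · simp only [lieEntry_rev, lieEntry_castLE, neg_sq, ← two_mul, ← Finset.mul_sum, nsmul_eq_mul]
  · intro i hi
    have := lieEntry_rev X x i
    rw [hi, self_eq_neg] at this
    simp [this]

/-- Up to a constant and a factor `2`, these power sums are traces of powers of `4 A ^ 2 + 2` for
`A` in `𝔱`, which conjugation preserves. -/
theorem powerSum_conj {X : ClassicalType} {n : ℕ} {g : classicalGroup X n}
    (hg : g ∈ Subgroup.normalizer (torus X n : Set (classicalGroup X n))) (x : Fin n → ℂ) (j : ℕ) :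
    ∑ i, (4 * (lieCoord X n (toMat g * torusLie X x * toMat g⁻¹)) i ^ 2 + 2) ^ j =
      ∑ i, (4 * x i ^ 2 + 2) ^ j := by
  obtain ⟨x', hx'⟩ := exists_conj_torusLie_eq hg x
  rw [hx', lieCoord_torusLie]
  let u : (Matrix (Fin (dim X n)) (Fin (dim X n)) ℂ)ˣ :=
    ⟨toMat g, toMat g⁻¹, by rw [← toMat_mul, mul_inv_cancel, toMat_one],
      by rw [← toMat_mul, inv_mul_cancel, toMat_one]⟩
  have hu : torusLie X x' = u * torusLie X x * (u⁻¹ : (Matrix _ _ ℂ)ˣ) := hx'.symm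
  have h : ((4 * torusLie X x' ^ 2 + 2) ^ j).trace = ((4 * torusLie X x ^ 2 + 2) ^ j).trace := by
    have h1 : 4 * torusLie X x' ^ 2 + 2 =
        u * (4 * torusLie X x ^ 2 + 2) * (u⁻¹ : (Matrix _ _ ℂ)ˣ) := by
      have c4 : (u : Matrix (Fin (dim X n)) (Fin (dim X n)) ℂ) * 4 = 4 * u :=
        (Commute.ofNat_right _ 4).eq
      have c2 : (u : Matrix (Fin (dim X n)) (Fin (dim X n)) ℂ) * 2 = 2 * u :=
        (Commute.ofNat_right _ 2).eq
      rw [hu, Units.conj_pow, mul_add, add_mul,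
        ← mul_assoc (u : Matrix (Fin (dim X n)) (Fin (dim X n)) ℂ) 4 _, c4, c2]
      simp only [mul_assoc, Units.mul_inv, mul_one]
    rw [h1, Units.conj_pow, Matrix.trace_units_conj]
  rw [trace_torusLie_pow, trace_torusLie_pow] at h
  linear_combination h / 2

theorem eval_aeval {R σ τ : Type*} [CommRing R] (z : τ → R) (f : σ → MvPolynomial τ R)
    (H : MvPolynomial σ R) : MvPolynomial.eval z (MvPolynomial.aeval f H) =
      MvPolynomial.eval (fun i => MvPolynomial.eval z (f i)) H := by
  induction H using MvPolynomial.induction_on with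
  | C a => simp
  | add p q hp hq => simp only [map_add, hp, hq]
  | mul_X p i hp => simp only [map_mul, hp, MvPolynomial.aeval_X, MvPolynomial.eval_X]

/-- A symmetric polynomial is a polynomial in the elementary symmetric functions, and over `ℂ`
Newton's formulas express these through the power sums. -/
theorem eval_eq_of_powerSum_eq {n : ℕ} {H : MvPolynomial (Fin n) ℂ} (hH : H.IsSymmetric)
    {u v : Fin n → ℂ} (h : ∀ j : ℕ, ∑ i, u i ^ j = ∑ i, v i ^ j) :
    MvPolynomial.eval u H = MvPolynomial.eval v H := by
  obtain ⟨P, rfl⟩ := exists_aeval_esymm_of_isSymmetric hH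
  have key : ∀ w : Fin n → ℂ, MvPolynomial.eval w (MvPolynomial.aeval
      (fun i : Fin n => MvPolynomial.esymm (Fin n) ℂ (i + 1)) P) =
      MvPolynomial.aeval (fun i : Fin n => newtonCoeff (fun j => ∑ a, w a ^ j) (i + 1)) P := by
    intro w
    rw [← MvPolynomial.coe_aeval_eq_eval, RingHom.coe_coe, ← AlgHom.comp_apply,
      MvPolynomial.comp_aeval]
    congr 2
    funext i
    rw [aeval_esymm_eq_sum, newtonCoeff_powerSum']
  rw [key, key]
  simp only [h]

/-- By `powerSum_conj` the normalizer preserves all power sums of the `4 x_i ^ 2 + 2`, so no upper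
bound on the Weyl group is needed. -/
theorem mem_weylInvariants_of_isSymmetric (X : ClassicalType) {n : ℕ}
    {H : MvPolynomial (Fin n) ℂ} (hH : H.IsSymmetric) :
    MvPolynomial.aeval (fun i : Fin n => (MvPolynomial.C 4 * MvPolynomial.X i ^ 2 +
      MvPolynomial.C 2 : MvPolynomial (Fin n) ℂ)) H ∈ weylInvariants X n := by
  intro g hg x
  have key : ∀ z : Fin n → ℂ, MvPolynomial.eval z (MvPolynomial.aeval
      (fun i : Fin n => (MvPolynomial.C 4 * MvPolynomial.X i ^ 2 +
        MvPolynomial.C 2 : MvPolynomial (Fin n) ℂ)) H) =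
      MvPolynomial.eval (fun i => 4 * z i ^ 2 + 2) H := by
    intro z
    rw [eval_aeval]
    simp
  rw [key, key]
  exact eval_eq_of_powerSum_eq hH (powerSum_conj hg x)

/-! ### Monomial matrices in the normalizer of the torus -/

/-- The Weyl group element is given by the monomial matrix `e_j ↦ d_j e_{σ j}`. The hypothesis `hd`
makes it preserve the form, `hdet` gives determinant `1`, and `hσ`, compatibility with reversal,
makes it normalize the torus (and enters the form computation). -/
theorem eval_of_mem_weylInvariants_of_perm {X : ClassicalType} {n : ℕ}
    {p : MvPolynomial (Fin n) ℂ} (hp : p ∈ weylInvariants X n)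
    (σ : Equiv.Perm (Fin (dim X n))) (d : Fin (dim X n) → ℂ)
    (hσ : ∀ i, σ i.rev = (σ i).rev)
    (hd : ∀ i, d i * d i.rev * antidiagEntry X n (σ i) = antidiagEntry X n i)
    (hdet : (Equiv.Perm.sign σ : ℂ) * ∏ i, d i = 1) (x : Fin n → ℂ) :
    MvPolynomial.eval (fun i => lieEntry X x (σ.symm (Fin.castLE (le_dim X n) i))) p =
      MvPolynomial.eval x p := by
  let P : Matrix (Fin (dim X n)) (Fin (dim X n)) ℂ := Matrix.of fun i j => if i = σ j then d j else 0
  have hPdet : P.det = 1 := by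
    have : P = (σ⁻¹).permMatrix ℂ * Matrix.diagonal d := by
      ext i j
      rw [Matrix.mul_diagonal]
      have : (σ⁻¹ i = j) ↔ i = σ j := by rw [Equiv.Perm.inv_eq_iff_eq]
      rw [Equiv.Perm.permMatrix, PEquiv.toMatrix_apply, Equiv.toPEquiv_apply]
      simp only [Option.mem_some_iff, this]
      simp [P]
    rw [this, Matrix.det_mul, Matrix.det_permutation, Matrix.det_diagonal, Equiv.Perm.sign_inv, hdet]
  have hPform : Pᵀ * formMatrix X n * P = formMatrix X n := by
    ext i j
    rw [Matrix.mul_assoc, Matrix.mul_apply, Finset.sum_eq_single (σ i)]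
    · rw [formMatrix_mul_apply, Matrix.transpose_apply]
      have h1 : ((σ i).rev = σ j) ↔ j = i.rev := by
        rw [← hσ, σ.injective.eq_iff, eq_comm]
      by_cases h : j = i.rev
      · subst h
        simp [P, formMatrix, hσ, ← hd i, -Fin.val_rev]
        ring
      · simp [P, formMatrix, h1, h]
    · intro k _ hk
      simp [P, hk]
    · intro h
      exact absurd (Finset.mem_univ _) h
  let g : classicalGroup X n := ⟨⟨P, hPdet⟩, hPform⟩
  have hg : toMat g = P := rfl
  -- Conjugation by the monomial matrix permutes diagonal entries. This serves both for the torus,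
  -- to prove normalization, and for its Lie algebra.
  have hcomm : ∀ s : Fin (dim X n) → ℂ,
      toMat g * Matrix.diagonal (s ∘ σ) = Matrix.diagonal s * toMat g := by
    intro s
    ext i j
    rw [Matrix.mul_diagonal, Matrix.diagonal_mul, hg]
    by_cases h : i = σ j
    · simp [P, h, mul_comm]
    · simp [P, h]
  have hperm : ∀ (τ : Equiv.Perm (Fin (dim X n))) (t : Fin n → ℂˣ),
      (∀ i, τ i.rev = (τ i).rev) → ∃ t', torusEntry X t ∘ τ = torusEntry X t' := by
    intro τ t hτ
    refine ⟨_, eq_torusEntry X ?_ ?_⟩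
    · intro i
      simp only [Function.comp_apply, hτ, torusEntry_rev]
    · intro i hi
      exact torusEntry_of_rev_eq X t _ (by rw [← hτ, hi])
  have hσ' : ∀ i, σ.symm i.rev = (σ.symm i).rev := by
    intro i
    rw [Equiv.symm_apply_eq, hσ, Equiv.apply_symm_apply]
  have hinj : ∀ a b : classicalGroup X n, toMat a = toMat b → a = b := fun a b h =>
    Subtype.ext (Subtype.ext h)
  have hnorm : g ∈ Subgroup.normalizer (torus X n : Set (classicalGroup X n)) := by
    rw [Subgroup.mem_normalizer_iff]
    intro h
    constructor
    · rintro ⟨t, rfl⟩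
      obtain ⟨t', ht'⟩ := hperm σ.symm t hσ'
      refine ⟨t', ?_⟩
      rw [eq_mul_inv_iff_mul_eq]
      apply hinj
      rw [toMat_mul, toMat_mul, toMat_torusHom, toMat_torusHom, ← hcomm, ← ht']
      congr 2
      funext i
      simp
    · rintro ⟨t, ht⟩
      obtain ⟨t', ht'⟩ := hperm σ t hσ
      refine ⟨t', ?_⟩
      rw [eq_mul_inv_iff_mul_eq] at ht
      apply mul_left_cancel (a := g)
      rw [← ht]
      apply hinj
      rw [toMat_mul, toMat_mul, toMat_torusHom, toMat_torusHom, ← hcomm, ← ht']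
      rfl
  rw [← hp g hnorm x]
  have hconj : toMat g * torusLie X x * toMat g⁻¹ =
      Matrix.diagonal (lieEntry X x ∘ σ.symm) := by
    have h := hcomm (lieEntry X x ∘ σ.symm)
    rw [Function.comp_assoc, Equiv.symm_comp_self, Function.comp_id] at h
    rw [torusLie_eq, h, Matrix.mul_assoc, ← toMat_mul, mul_inv_cancel, toMat_one, Matrix.mul_one]
  rw [hconj]
  congr 2
  funext i
  simp [lieCoord]

theorem castLE_rev_ne (X : ClassicalType) {n : ℕ} (i j : Fin n) :
    (Fin.castLE (le_dim X n) i).rev ≠ Fin.castLE (le_dim X n) j := by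
  intro h
  have h1 := congrArg Fin.val h
  have h2 := two_mul_le_dim X n
  have h3 := i.2
  have h4 := j.2
  simp only [Fin.val_rev, Fin.val_castLE] at h1
  omega

theorem antidiagEntry_castLE (X : ClassicalType) {n : ℕ} (i j : Fin n) :
    antidiagEntry X n (Fin.castLE (le_dim X n) i) =
      antidiagEntry X n (Fin.castLE (le_dim X n) j) := by
  have h3 := i.2
  have h4 := j.2
  cases X <;> simp [antidiagEntry, h3, h4, h3.ne, h4.ne]

theorem antidiagEntry_rev_castLE (X : ClassicalType) {n : ℕ} (i j : Fin n) :
    antidiagEntry X n (Fin.castLE (le_dim X n) i).rev =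
      antidiagEntry X n (Fin.castLE (le_dim X n) j).rev := by
  have h3 := i.2
  have h4 := j.2
  cases X
  · have hd : dim .B n = 2 * n + 1 := rfl
    simp only [antidiagEntry, Fin.val_rev, Fin.val_castLE]
    rw [if_neg (by omega), if_neg (by omega)]
  · have hd : dim .C n = 2 * n := rfl
    simp only [antidiagEntry, Fin.val_rev, Fin.val_castLE]
    rw [if_neg (by omega), if_neg (by omega)]

/-- A transposition of coordinates is realized by swapping two basis vectors and simultaneously
their mirror images. Being a product of two transpositions it has determinant `1`, and the
antidiagonal entries involved agree within each half. -/
theorem isSymmetric_of_mem_weylInvariants {X : ClassicalType} {n : ℕ}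
    {p : MvPolynomial (Fin n) ℂ} (hp : p ∈ weylInvariants X n) : p.IsSymmetric := by
  intro e
  induction e using Equiv.Perm.swap_induction_on with
  | one => exact MvPolynomial.rename_id_apply p
  | swap_mul f i j hij ih =>
    have hswap : MvPolynomial.rename (Equiv.swap i j) p = p := by
      apply MvPolynomial.funext
      intro x
      rw [MvPolynomial.eval_rename]
      let c : Fin n → Fin (dim X n) := Fin.castLE (le_dim X n)
      have hc : Function.Injective c := Fin.castLE_injective _
      have hr : ∀ k l, (c k).rev ≠ c l := castLE_rev_ne X
      have hr' : ∀ k l, c l ≠ (c k).rev := fun k l => (hr k l).symm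
      let σ : Equiv.Perm (Fin (dim X n)) :=
        Equiv.swap (c i) (c j) * Equiv.swap (c i).rev (c j).rev
      have hσc : ∀ k, σ (c k) = c (Equiv.swap i j k) := by
        intro k
        simp only [σ, Equiv.Perm.mul_apply]
        rw [Equiv.swap_apply_of_ne_of_ne (hr' _ _) (hr' _ _), hc.swap_apply]
      have hσr : ∀ k, σ (c k).rev = (c (Equiv.swap i j k)).rev := by
        intro k
        simp only [σ, Equiv.Perm.mul_apply]
        rw [Fin.rev_injective.swap_apply, hc.swap_apply,
          Equiv.swap_apply_of_ne_of_ne (hr _ _) (hr _ _)]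
      have hσm : ∀ k : Fin (dim X n), k.rev = k → σ k = k := by
        intro k hk
        have h1 : ∀ l, k ≠ c l := fun l h => hr l l (by rw [← h, hk])
        have h2 : ∀ l, k ≠ (c l).rev := fun l h => h1 l (by rw [← hk, h, Fin.rev_rev])
        simp only [σ, Equiv.Perm.mul_apply]
        rw [Equiv.swap_apply_of_ne_of_ne (h2 _) (h2 _), Equiv.swap_apply_of_ne_of_ne (h1 _) (h1 _)]
      have hσs : σ.symm = σ := by
        rw [Equiv.symm_eq_iff_trans_eq_refl]
        apply Equiv.ext
        intro k
        change σ (σ k) = k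
        rcases eq_castLE_or_rev X k with ⟨l, rfl⟩ | ⟨l, rfl⟩ | h
        · erw [hσc, hσc, Equiv.swap_apply_self]
        · erw [hσr, hσr, Equiv.swap_apply_self]
        · rw [hσm k h, hσm k h]
      have := eval_of_mem_weylInvariants_of_perm hp σ (fun _ => 1) ?_ ?_ ?_ x
      · rw [← this]
        congr 2
        funext k
        rw [hσs]
        exact ((congrArg (lieEntry X x) (hσc k)).trans (lieEntry_castLE X x _)).symm
      · intro k
        rcases eq_castLE_or_rev X k with ⟨l, rfl⟩ | ⟨l, rfl⟩ | h
        · exact (hσr l).trans (congrArg Fin.rev (hσc l)).symm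
        · rw [Fin.rev_rev]
          exact (hσc l).trans ((congrArg Fin.rev (hσr l)).trans (Fin.rev_rev _)).symm
        · rw [h, hσm k h, h]
      · intro k
        rw [one_mul, one_mul]
        rcases eq_castLE_or_rev X k with ⟨l, rfl⟩ | ⟨l, rfl⟩ | h
        · exact (congrArg (fun a => antidiagEntry X n (a : Fin (dim X n))) (hσc l)).trans
            (antidiagEntry_castLE X _ _)
        · exact (congrArg (fun a => antidiagEntry X n (a : Fin (dim X n))) (hσr l)).trans
            (antidiagEntry_rev_castLE X _ _)
        · rw [hσm k h]
      · have h1 : c i ≠ c j := hc.ne hij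
        have h2 : (c i).rev ≠ (c j).rev := Fin.rev_injective.ne h1
        simp [σ, Equiv.Perm.sign_swap h1, Equiv.Perm.sign_swap h2]
    rw [Equiv.Perm.coe_mul, ← MvPolynomial.rename_rename, ih, hswap]

/-- The sign change of `x_i` is realized by swapping the `i`-th basis vector with its mirror image.
This swap has determinant `-1`, which one entry `-1` of `d` corrects; its place depends on the type.
-/
theorem eval_neg_of_mem_weylInvariants {X : ClassicalType} {n : ℕ}
    {p : MvPolynomial (Fin n) ℂ} (hp : p ∈ weylInvariants X n) (i : Fin n) (x : Fin n → ℂ) :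
    MvPolynomial.eval (fun j => if j = i then -x j else x j) p = MvPolynomial.eval x p := by
  let c : Fin n → Fin (dim X n) := Fin.castLE (le_dim X n)
  have hc : Function.Injective c := Fin.castLE_injective _
  have hr : ∀ k l, (c k).rev ≠ c l := castLE_rev_ne X
  have hr' : ∀ k l, c l ≠ (c k).rev := fun k l => (hr k l).symm
  let σ : Equiv.Perm (Fin (dim X n)) := Equiv.swap (c i) (c i).rev
  have hσrev : ∀ k, σ k.rev = (σ k).rev := by
    intro k
    by_cases h1 : k = c i
    · rw [h1]
      simp only [σ, Equiv.swap_apply_left, Equiv.swap_apply_right, Fin.rev_rev]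
    · by_cases h2 : k = (c i).rev
      · rw [h2, Fin.rev_rev]
        simp only [σ, Equiv.swap_apply_left, Equiv.swap_apply_right]
      · have h3 : k.rev ≠ c i := fun h => h2 (by rw [← h, Fin.rev_rev])
        have h4 : k.rev ≠ (c i).rev := fun h => h1 (Fin.rev_injective h)
        simp only [σ]
        rw [Equiv.swap_apply_of_ne_of_ne h1 h2, Equiv.swap_apply_of_ne_of_ne h3 h4]
  have hfin : (fun k => lieEntry X x (σ.symm (c k))) = fun j => if j = i then -x j else x j := by
    funext k
    simp only [σ, Equiv.symm_swap]
    split_ifs with h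
    · subst h
      rw [Equiv.swap_apply_left, lieEntry_rev]
      exact congrArg _ (lieEntry_castLE X x k)
    · rw [Equiv.swap_apply_of_ne_of_ne (hc.ne h) (hr' _ _)]
      exact lieEntry_castLE X x k
  have hdet : ∀ m : Fin (dim X n), (Equiv.Perm.sign σ : ℂ) * ∏ k, Function.update (fun _ => (1 : ℂ)) m (-1) k = 1 := by
    intro m
    rw [Finset.prod_update_of_mem (Finset.mem_univ m)]
    simp [σ, Equiv.Perm.sign_swap (hr' i i)]
  rw [← hfin]
  cases X with
  | B =>
    have hn : n < dim .B n := by simp only [dim]; omega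
    let m : Fin (dim .B n) := ⟨n, hn⟩
    have hm : m.rev = m := by apply Fin.ext; simp [m, dim]; omega
    have hmr : ∀ k : Fin (dim .B n), k.rev = m ↔ k = m := by
      intro k
      rw [← hm, Fin.rev_inj, hm]
    have hmi : c i ≠ m := fun h => i.2.ne (congrArg Fin.val h)
    have hmi' : (c i).rev ≠ m := fun h => hmi ((hmr _).1 h)
    -- In type `B` the entry `-1` sits at the middle vector, where it enters the form squared.
    refine eval_of_mem_weylInvariants_of_perm hp σ (Function.update (fun _ => 1) m (-1)) hσrev ?_
      (hdet m) x
    intro k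
    have h1 : Function.update (fun _ => (1 : ℂ)) m (-1) k *
        Function.update (fun _ => (1 : ℂ)) m (-1) k.rev = 1 := by
      simp only [Function.update_apply, hmr]
      split_ifs <;> norm_num
    rw [h1, one_mul]
    have h2 : ∀ k : Fin (dim .B n), k ≠ m → antidiagEntry .B n k = 1 := by
      intro k hk
      have : (k : ℕ) ≠ n := fun h => hk (Fin.ext h)
      simp [antidiagEntry, this]
    by_cases h3 : k = c i
    · rw [h3, Equiv.swap_apply_left, h2 _ hmi, h2 _ hmi']
    · by_cases h4 : k = (c i).rev
      · rw [h4, Equiv.swap_apply_right, h2 _ hmi, h2 _ hmi']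
      · rw [Equiv.swap_apply_of_ne_of_ne h3 h4]
  | C =>
    -- In type `C` the entry `-1` sits at one of the two swapped vectors: the two antidiagonal
    -- entries have opposite signs, so the form requires it as well.
    refine eval_of_mem_weylInvariants_of_perm hp σ (Function.update (fun _ => 1) (c i) (-1)) hσrev ?_
      (hdet (c i)) x
    have e1 : antidiagEntry .C n (c i) = -1 := if_pos i.2
    have e2 : antidiagEntry .C n (c i).rev = 1 := by
      refine if_neg ?_
      have h1 := i.2
      have h2 : dim .C n = 2 * n := rfl
      simp only [Fin.val_rev, c, Fin.val_castLE]
      omega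
    intro k
    by_cases h3 : k = c i
    · rw [h3, Equiv.swap_apply_left, e1, e2, Function.update_self, Function.update_of_ne (hr i i)]
      norm_num
    · by_cases h4 : k = (c i).rev
      · rw [h4, Equiv.swap_apply_right, e1, e2, Fin.rev_rev, Function.update_self,
          Function.update_of_ne (hr i i)]
        norm_num
      · have h5 : k.rev ≠ c i := fun h => h4 (by rw [← h, Fin.rev_rev])
        rw [Equiv.swap_apply_of_ne_of_ne h3 h4, Function.update_of_ne h3, Function.update_of_ne h5,
          one_mul, one_mul]

theorem coeff_aeval_neg {n : ℕ} (i : Fin n) (p : MvPolynomial (Fin n) ℂ) (m : Fin n →₀ ℕ) :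
    MvPolynomial.coeff m (MvPolynomial.aeval (fun j => if j = i then -MvPolynomial.X j
      else (MvPolynomial.X j : MvPolynomial (Fin n) ℂ)) p) =
      (-1) ^ m i * MvPolynomial.coeff m p := by
  classical
  induction p using MvPolynomial.induction_on' with
  | monomial u a =>
    have h : ∏ j, (if j = i then -MvPolynomial.X j
        else (MvPolynomial.X j : MvPolynomial (Fin n) ℂ)) ^ u j =
        MvPolynomial.C ((-1) ^ u i) * ∏ j, MvPolynomial.X j ^ u j := by
      rw [← Finset.mul_prod_erase _ _ (Finset.mem_univ i),
        ← Finset.mul_prod_erase _ (fun j => MvPolynomial.X j ^ u j) (Finset.mem_univ i), if_pos rfl,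
        neg_pow, map_pow, map_neg, map_one, mul_assoc]
      congr 2
      refine Finset.prod_congr rfl fun j hj => ?_
      rw [if_neg (Finset.ne_of_mem_erase hj)]
    rw [MvPolynomial.aeval_monomial, Finsupp.prod_fintype _ _ (fun _ => pow_zero _), h,
      MvPolynomial.algebraMap_eq, mul_left_comm,
      ← Finsupp.prod_fintype u (fun j k => (MvPolynomial.X j : MvPolynomial (Fin n) ℂ) ^ k)
        (fun _ => pow_zero _), ← MvPolynomial.monomial_eq, MvPolynomial.coeff_C_mul,
      MvPolynomial.coeff_monomial]
    split_ifs with hu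
    · rw [hu]
    · simp
  | add p q hp hq => rw [map_add, MvPolynomial.coeff_add, hp, hq, MvPolynomial.coeff_add, mul_add]

/-- The sign change of `x_i` multiplies the coefficient at `m` by `(-1) ^ m i`, so only even
exponents occur. Symmetry descends to `q` because `expand 2` is injective and commutes with
renaming. -/
theorem exists_expand_eq_of_mem_weylInvariants {X : ClassicalType} {n : ℕ}
    {p : MvPolynomial (Fin n) ℂ} (hp : p ∈ weylInvariants X n) :
    ∃ q : MvPolynomial (Fin n) ℂ, MvPolynomial.expand 2 q = p ∧ q.IsSymmetric := by
  have heven : ∀ m ∈ p.support, ∀ i, Even (m i) := by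
    intro m hm i
    by_contra hodd
    have h : MvPolynomial.aeval (fun j => if j = i then -MvPolynomial.X j
      else (MvPolynomial.X j : MvPolynomial (Fin n) ℂ)) p = p := by
      apply MvPolynomial.funext
      intro x
      rw [eval_aeval, ← eval_neg_of_mem_weylInvariants hp i x]
      congr 2
      funext j
      split_ifs <;> simp
    have h1 := coeff_aeval_neg i p m
    rw [h, (Nat.not_even_iff_odd.1 hodd).neg_one_pow, neg_one_mul, self_eq_neg] at h1
    exact MvPolynomial.mem_support_iff.1 hm h1
  have hq : MvPolynomial.expand 2 (∑ m ∈ p.support, MvPolynomial.monomial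
      (m.mapRange (fun k => k / 2) (by norm_num)) (MvPolynomial.coeff m p)) = p := by
    rw [map_sum]
    conv_rhs => rw [MvPolynomial.as_sum p]
    refine Finset.sum_congr rfl fun m hm => ?_
    rw [MvPolynomial.expand_monomial]
    refine congrArg (fun a => MvPolynomial.monomial a (MvPolynomial.coeff m p))
      (Finsupp.ext fun i => ?_)
    have := Nat.two_mul_div_two_of_even (heven m hm i)
    simpa using this
  refine ⟨_, hq, fun e => MvPolynomial.expand_injective two_pos ?_⟩
  rw [← MvPolynomial.rename_expand, hq]
  exact isSymmetric_of_mem_weylInvariants hp e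

/-! ### Polynomial characters as symmetric polynomials -/

/-- The functions `t ↦ t_i ^ 2 + t_i ^ (-2)` on the torus. -/
def yFun {n : ℕ} (i : Fin n) : TorusFun n := fun t => (t i : ℂ) ^ 2 + (t i : ℂ) ^ (-2 : ℤ)

theorem yFun_eq {n : ℕ} (i : Fin n) (t : Fin n → ℂˣ) :
    4 * (((t i : ℂ) - (t i : ℂ)⁻¹) / 2) ^ 2 + 2 = yFun i t := by
  have h : (t i : ℂ) * (t i : ℂ)⁻¹ = 1 := mul_inv_cancel₀ (t i).ne_zero
  have h2 : (t i : ℂ) ^ (-2 : ℤ) = (t i : ℂ)⁻¹ ^ 2 := by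
    rw [zpow_neg, inv_pow, zpow_ofNat]
  rw [yFun, h2]
  linear_combination -2 * h

/-- The squares `x_i ^ 2` and the `y_i` differ by the affine substitution `y_i = 4 x_i ^ 2 + 2`, the
same for every `i`, so symmetry is preserved both ways. -/
theorem mem_repPolyC_iff {X : ClassicalType} {n : ℕ} {f : TorusFun n} :
    f ∈ repPolyC X n ↔ ∃ H : MvPolynomial (Fin n) ℂ, H.IsSymmetric ∧
      ∀ t, f t = MvPolynomial.eval (fun i => yFun i t) H := by
  rw [repPolyC, Subalgebra.mem_map]
  constructor
  · rintro ⟨p, hp, rfl⟩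
    obtain ⟨q, rfl, hq⟩ := exists_expand_eq_of_mem_weylInvariants hp
    refine ⟨MvPolynomial.aeval (fun i => (MvPolynomial.C (1 / 4) *
      (MvPolynomial.X i - MvPolynomial.C 2) : MvPolynomial (Fin n) ℂ)) q, ?_, ?_⟩
    · intro e
      conv_rhs => rw [← hq e]
      rw [MvPolynomial.aeval_rename, ← AlgHom.comp_apply, MvPolynomial.comp_aeval]
      congr 2
      funext i
      simp
    · intro t
      rw [springerPullback_apply, eval_aeval, MvPolynomial.eval_expand]
      congr 2
      funext i
      simp only [map_mul, map_sub, MvPolynomial.eval_C, MvPolynomial.eval_X, ← yFun_eq,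
        Pi.pow_apply]
      ring
  · rintro ⟨H, hH, hf⟩
    refine ⟨_, mem_weylInvariants_of_isSymmetric X hH, funext fun t => ?_⟩
    rw [hf]
    rw [springerPullback_apply, eval_aeval]
    congr 2
    funext i
    simp only [map_mul, map_add, map_pow, MvPolynomial.eval_C, MvPolynomial.eval_X, ← yFun_eq]

/-! ### Integrality -/

/-- Linear combinations of the characters with exponents in `A`. -/
def charSpan {n : ℕ} (A : Set (Fin n → ℤ)) : Submodule ℂ (TorusFun n) :=
  Submodule.span ℂ ((fun m => (⇑(torusChar m) : TorusFun n)) '' A)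

theorem torusChar_mem_charSpan {n : ℕ} {A : Set (Fin n → ℤ)} {m : Fin n → ℤ} (hm : m ∈ A) :
    (⇑(torusChar m) : TorusFun n) ∈ charSpan A :=
  Submodule.subset_span ⟨m, hm, rfl⟩

theorem charSpan_mono {n : ℕ} {A B : Set (Fin n → ℤ)} (h : A ⊆ B) : charSpan A ≤ charSpan B :=
  Submodule.span_mono (Set.image_mono h)

theorem mul_mem_charSpan {n : ℕ} {A B C : Set (Fin n → ℤ)}
    (h : ∀ a ∈ A, ∀ b ∈ B, a + b ∈ C) {f g : TorusFun n} (hf : f ∈ charSpan A)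
    (hg : g ∈ charSpan B) : f * g ∈ charSpan C := by
  have h' : f * g ∈ charSpan A * charSpan B := Submodule.mul_mem_mul hf hg
  rw [charSpan, charSpan, Submodule.span_mul_span] at h'
  refine Submodule.span_mono ?_ h'
  rintro _ ⟨_, ⟨m, hm, rfl⟩, _, ⟨m', hm', rfl⟩, rfl⟩
  exact ⟨m + m', h m hm m' hm', torusChar_add m m'⟩

/-- The function `f` is the character `t ^ d` plus a combination of characters with smaller
exponents, for the componentwise order. -/
def HasTopTerm {n : ℕ} (f : TorusFun n) (d : Fin n → ℤ) : Prop :=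
  f - torusChar d ∈ charSpan (Set.Iio d)

theorem HasTopTerm.mem_charSpan {n : ℕ} {f : TorusFun n} {d : Fin n → ℤ} (h : HasTopTerm f d) :
    f ∈ charSpan (Set.Iic d) := by
  rw [← sub_add_cancel f (torusChar d)]
  exact Submodule.add_mem _ (charSpan_mono Set.Iio_subset_Iic_self h)
    (torusChar_mem_charSpan Set.self_mem_Iic)

theorem hasTopTerm_one {n : ℕ} : HasTopTerm (1 : TorusFun n) 0 := by
  rw [HasTopTerm, torusChar_zero, sub_self]
  exact Submodule.zero_mem _

theorem HasTopTerm.mul {n : ℕ} {f g : TorusFun n} {d e : Fin n → ℤ} (hf : HasTopTerm f d)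
    (hg : HasTopTerm g e) : HasTopTerm (f * g) (d + e) := by
  have h : f * g - torusChar (d + e) =
      (f - torusChar d) * g + torusChar d * (g - torusChar e) := by
    rw [torusChar_add]
    ring
  rw [HasTopTerm, h]
  refine Submodule.add_mem _ (mul_mem_charSpan ?_ hf hg.mem_charSpan)
    (mul_mem_charSpan ?_ (torusChar_mem_charSpan (Set.self_mem_Iic (a := d))) hg)
  · intro a ha b hb
    exact add_lt_add_of_lt_of_le (Set.mem_Iio.1 ha) (Set.mem_Iic.1 hb)
  · intro a ha b hb
    exact add_lt_add_of_le_of_lt (Set.mem_Iic.1 ha) (Set.mem_Iio.1 hb)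

theorem HasTopTerm.pow {n : ℕ} {f : TorusFun n} {d : Fin n → ℤ} (hf : HasTopTerm f d) (k : ℕ) :
    HasTopTerm (f ^ k) (k • d) := by
  induction k with
  | zero => rw [pow_zero, zero_smul]; exact hasTopTerm_one
  | succ k ih => rw [pow_succ, succ_nsmul]; exact ih.mul hf

theorem HasTopTerm.prod {n : ℕ} {ι : Type*} {f : ι → TorusFun n} {d : ι → Fin n → ℤ}
    (s : Finset ι) (hf : ∀ i, HasTopTerm (f i) (d i)) :
    HasTopTerm (∏ i ∈ s, f i) (∑ i ∈ s, d i) := by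
  classical
  induction s using Finset.induction_on with
  | empty => exact hasTopTerm_one
  | insert a s ha ih =>
    rw [Finset.prod_insert ha, Finset.sum_insert ha]
    exact (hf a).mul ih

theorem yFun_eq_torusChar {n : ℕ} (i : Fin n) :
    yFun i = torusChar (Pi.single i 2) + torusChar (Pi.single i (-2)) := by
  funext t
  rw [Pi.add_apply, torusChar_single, torusChar_single, yFun]
  rfl

theorem hasTopTerm_yFun {n : ℕ} (i : Fin n) : HasTopTerm (yFun i) (Pi.single i 2) := by
  rw [HasTopTerm, yFun_eq_torusChar, add_sub_cancel_left]
  refine torusChar_mem_charSpan ?_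
  rw [Set.mem_Iio, Pi.lt_def]
  refine ⟨fun j => ?_, i, by simp⟩
  by_cases h : j = i
  · subst h
    simp
  · simp [h]

theorem hasTopTerm_monomial {n : ℕ} (m : Fin n →₀ ℕ) :
    HasTopTerm (∏ i, (yFun i : TorusFun n) ^ m i) (fun i => 2 * m i) := by
  have h := HasTopTerm.prod Finset.univ fun i => (hasTopTerm_yFun i).pow (m i)
  have e : ∑ i, m i • (Pi.single i 2 : Fin n → ℤ) = fun i => 2 * (m i : ℤ) := by
    funext j
    rw [Finset.sum_apply, Finset.sum_eq_single j]
    · simp [mul_comm]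
    · intro b _ hb
      simp [Pi.single_eq_of_ne hb.symm]
    · simp
  rwa [e] at h

theorem yFun_mem_intLaurentRing {n : ℕ} (i : Fin n) : yFun i ∈ intLaurentRing n := by
  rw [yFun_eq_torusChar]
  exact Subring.add_mem _ (Subring.subset_closure ⟨_, rfl⟩) (Subring.subset_closure ⟨_, rfl⟩)

theorem eq_zero_of_smul_mem_charSpan {n : ℕ} {d : Fin n → ℤ} {c : ℂ}
    (h : c • (⇑(torusChar d) : TorusFun n) ∈ charSpan {d}ᶜ) : c = 0 := by
  by_contra hc
  refine (linearIndependent_torusChar n).notMem_span_image (s := {d}ᶜ) (x := d) (by simp) ?_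
  have := Submodule.smul_mem _ c⁻¹ h
  rwa [smul_smul, inv_mul_cancel₀ hc, one_smul] at this

/-- At an exponent `a` that is maximal among those with a non-integral coefficient, the character
with exponents `2 a` receives only that coefficient once the integral part of `H` is removed.
Maximality for the partial order suffices: a monomial containing this character has an exponent `b ≥
a`. -/
theorem exists_int_coeff {n : ℕ} {H : MvPolynomial (Fin n) ℂ}
    (hH : (fun t => MvPolynomial.eval (fun i => yFun i t) H) ∈ intLaurentRing n)
    (m : Fin n →₀ ℕ) : ∃ a : ℤ, MvPolynomial.coeff m H = a := by
  classical
  by_contra hm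
  let Y : (Fin n →₀ ℕ) → TorusFun n := fun m => ∏ i, yFun i ^ m i
  let B : Finset (Fin n →₀ ℕ) := {b ∈ H.support | ¬ ∃ a : ℤ, MvPolynomial.coeff b H = a}
  have hB : B.Nonempty := by
    refine ⟨m, Finset.mem_filter.2 ⟨MvPolynomial.mem_support_iff.2 fun h => hm ⟨0, ?_⟩, hm⟩⟩
    rw [h, Int.cast_zero]
  obtain ⟨a, ha, hmax⟩ := B.exists_maximal hB
  have hsum : (fun t => MvPolynomial.eval (fun i => yFun i t) H) =
      ∑ b ∈ H.support, MvPolynomial.coeff b H • Y b := by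
    funext t
    rw [MvPolynomial.eval_eq', Finset.sum_apply]
    refine Finset.sum_congr rfl fun b _ => ?_
    simp [Y]
  -- The monomials with integral coefficients are themselves integral Laurent polynomials, so they
  -- can be subtracted.
  have hBint : ∑ b ∈ B, MvPolynomial.coeff b H • Y b ∈ intLaurentRing n := by
    rw [hsum, ← Finset.sum_filter_add_sum_filter_not _
      (fun b => ¬ ∃ a : ℤ, MvPolynomial.coeff b H = a)] at hH
    refine (add_mem_cancel_right (Subring.sum_mem _ fun b hb => ?_)).1 hH
    obtain ⟨c, hc⟩ := not_not.1 (Finset.mem_filter.1 hb).2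
    rw [hc, Int.cast_smul_eq_zsmul]
    exact Subring.zsmul_mem _ (Subring.prod_mem _ fun i _ =>
      Subring.pow_mem _ (yFun_mem_intLaurentRing i) _) c
  obtain ⟨c, hc⟩ := exists_int_expansion hBint
  let d : Fin n → ℤ := fun i => 2 * a i
  have hother : ∀ b ∈ B, b ≠ a → Y b ∈ charSpan {d}ᶜ := by
    intro b hb hne
    refine charSpan_mono ?_ (hasTopTerm_monomial b).mem_charSpan
    intro k hk hkd
    have hkd' : k = d := hkd
    subst hkd'
    have hab : a ≤ b := fun i => by
      have := hk i
      simp only [d] at this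
      omega
    exact hne (le_antisymm (hmax hb hab) hab)
  -- The coefficient of the character `d` is computed in two ways, modulo the other characters: here
  -- from leading terms, in `h2` from the integral expansion.
  have h1 : ∑ b ∈ B, MvPolynomial.coeff b H • Y b -
      MvPolynomial.coeff a H • (⇑(torusChar d) : TorusFun n) ∈ charSpan {d}ᶜ := by
    rw [← Finset.add_sum_erase _ _ ha, add_sub_right_comm, ← smul_sub]
    refine Submodule.add_mem _ (Submodule.smul_mem _ _ ?_) (Submodule.sum_mem _ fun b hb => ?_)
    · exact charSpan_mono (fun k hk hkd => (ne_of_lt hk) hkd) (hasTopTerm_monomial a)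
    · exact Submodule.smul_mem _ _ (hother b (Finset.mem_of_mem_erase hb)
        (Finset.ne_of_mem_erase hb))
  have h2 : ∑ b ∈ B, MvPolynomial.coeff b H • Y b -
      (c d : ℂ) • (⇑(torusChar d) : TorusFun n) ∈ charSpan {d}ᶜ := by
    have e : (c.sum fun m a => (a : ℂ) • (⇑(torusChar m) : TorusFun n)) =
        (c d : ℂ) • (⇑(torusChar d) : TorusFun n) +
          ∑ m ∈ c.support.erase d, (c m : ℂ) • (⇑(torusChar m) : TorusFun n) := by
      by_cases hd : d ∈ c.support
      · exact (Finset.add_sum_erase _ _ hd).symm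
      · rw [Finsupp.notMem_support_iff.1 hd, Finset.erase_eq_of_notMem hd]
        simp [Finsupp.sum]
    rw [hc, e, add_sub_cancel_left]
    exact Submodule.sum_mem _ fun m hm => Submodule.smul_mem _ _
      (torusChar_mem_charSpan (Finset.ne_of_mem_erase hm))
  have h3 := Submodule.sub_mem _ h2 h1
  rw [sub_sub_sub_cancel_left, ← sub_smul] at h3
  exact (Finset.mem_filter.1 ha).2 ⟨c d, sub_eq_zero.1 (eq_zero_of_smul_mem_charSpan h3)⟩

theorem exists_int_polynomial {n : ℕ} {H : MvPolynomial (Fin n) ℂ} (hsymm : H.IsSymmetric)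
    (hH : (fun t => MvPolynomial.eval (fun i => yFun i t) H) ∈ intLaurentRing n) :
    ∃ H₀ : MvPolynomial (Fin n) ℤ, H₀.IsSymmetric ∧ MvPolynomial.map (Int.castRingHom ℂ) H₀ = H := by
  choose a ha using exists_int_coeff hH
  have h : MvPolynomial.map (Int.castRingHom ℂ)
      (∑ m ∈ H.support, MvPolynomial.monomial m (a m)) = H := by
    conv_rhs => rw [MvPolynomial.as_sum H]
    simp [ha]
  refine ⟨_, fun e => MvPolynomial.map_injective (Int.castRingHom ℂ)
    (RingHom.injective_int _) ?_, h⟩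
  rw [MvPolynomial.map_rename, h, hsymm e]

/-! ### Symmetric polynomials and the coefficients of `∏ (1 + y_j q + q ^ 2)` -/

/-- The values at `y` of the symmetric polynomials with integral coefficients. -/
def symSubring {R : Type*} [CommRing R] {n : ℕ} (y : Fin n → R) : Subring R :=
  (MvPolynomial.symmetricSubalgebra (Fin n) ℤ).toSubring.map
    (MvPolynomial.eval₂Hom (Int.castRingHom R) y)

/-- The coefficient of `q ^ k` in `∏ (1 + y_j q + q ^ 2)`. -/
def quadCoeff {R : Type*} [CommRing R] {n : ℕ} (y : Fin n → R) (k : ℕ) : R :=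
  (∏ j, (1 + Polynomial.C (y j) * Polynomial.X + Polynomial.X ^ 2)).coeff k

theorem map_quadCoeff {R S : Type*} [CommRing R] [CommRing S] {n : ℕ} (f : R →+* S)
    (y : Fin n → R) (k : ℕ) : f (quadCoeff y k) = quadCoeff (fun j => f (y j)) k := by
  rw [quadCoeff, ← Polynomial.coeff_map, Polynomial.map_prod]
  simp [quadCoeff]

theorem quadCoeff_mem_symSubring {R : Type*} [CommRing R] {n : ℕ} (y : Fin n → R) (k : ℕ) :
    quadCoeff y k ∈ symSubring y := by
  refine ⟨quadCoeff (fun j => (MvPolynomial.X j : MvPolynomial (Fin n) ℤ)) k, ?_, ?_⟩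
  · refine isSymmetric_coeff (fun e => ?_) k
    rw [Polynomial.map_prod]
    refine Fintype.prod_equiv e _ _ fun i => ?_
    simp
  · rw [map_quadCoeff]
    simp

/-- Each factor is split as `y_j q + (1 + q ^ 2)`: choosing the first summand on an `m`-element set
gives `e_m(y) q ^ m (1 + q ^ 2) ^ (n - m)`. -/
theorem quadCoeff_eq_sum {R : Type*} [CommRing R] {n : ℕ} (y : Fin n → R) (k : ℕ) :
    quadCoeff y k = ∑ m ∈ Finset.range (n + 1),
      if m ≤ k then (∑ t ∈ Finset.univ.powersetCard m, ∏ j ∈ t, y j) *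
        ((1 + Polynomial.X ^ 2 : Polynomial R) ^ (n - m)).coeff (k - m) else 0 := by
  have h : ∀ j, 1 + Polynomial.C (y j) * Polynomial.X + Polynomial.X ^ 2 =
      Polynomial.C (y j) * Polynomial.X + (1 + Polynomial.X ^ 2) := fun j => by ring
  rw [quadCoeff, Finset.prod_congr rfl fun j _ => h j, Finset.prod_add, Finset.sum_powerset,
    Polynomial.finsetSum_coeff, Finset.card_univ, Fintype.card_fin]
  refine Finset.sum_congr rfl fun m _ => ?_
  rw [Polynomial.finsetSum_coeff]
  split_ifs with hm
  · rw [Finset.sum_mul]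
    refine Finset.sum_congr rfl fun t ht => ?_
    have hc := (Finset.mem_powersetCard.1 ht).2
    rw [Finset.prod_mul_distrib, Finset.prod_const, Finset.prod_const, ← map_prod, hc,
      Finset.card_sdiff_of_subset (Finset.subset_univ t), hc, Finset.card_univ, Fintype.card_fin,
      mul_assoc, Polynomial.coeff_C_mul, Polynomial.coeff_X_pow_mul', if_pos hm]
  · refine Finset.sum_eq_zero fun t ht => ?_
    have hc := (Finset.mem_powersetCard.1 ht).2
    rw [Finset.prod_mul_distrib, Finset.prod_const, ← map_prod, hc, mul_assoc,
      Polynomial.coeff_C_mul, Polynomial.coeff_X_pow_mul', if_neg hm, mul_zero]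

/-- By `quadCoeff_eq_sum`, the `k`-th coefficient is `e_k(y)` plus an integral combination of the
`e_m(y)` with `m < k`. This unitriangular system is inverted over `ℤ`. -/
theorem symSubring_le_closure {R : Type*} [CommRing R] {n : ℕ} (y : Fin n → R) :
    symSubring y ≤ Subring.closure {z | ∃ i : ℕ, 1 ≤ i ∧ i ≤ n ∧ z = quadCoeff y i} := by
  set S := Subring.closure {z | ∃ i : ℕ, 1 ≤ i ∧ i ≤ n ∧ z = quadCoeff y i}
  have hint : ∀ N l : ℕ, ((1 + Polynomial.X ^ 2 : Polynomial R) ^ N).coeff l ∈ S := by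
    intro N l
    have : (1 + Polynomial.X ^ 2 : Polynomial R) ^ N =
        ((1 + Polynomial.X ^ 2 : Polynomial ℤ) ^ N).map (Int.castRingHom R) := by simp
    rw [this, Polynomial.coeff_map]
    exact intCast_mem S _
  have he : ∀ k ≤ n, ∑ t ∈ Finset.univ.powersetCard k, ∏ j ∈ t, y j ∈ S := by
    intro k
    induction k using Nat.strong_induction_on with
    | _ k ih =>
      intro hk
      rcases Nat.eq_zero_or_pos k with rfl | hk0
      · simp
      · have h := quadCoeff_eq_sum y k
        rw [← Finset.add_sum_erase _ _ (Finset.mem_range.2 (Nat.lt_succ_of_le hk)), if_pos le_rfl,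
          Nat.sub_self] at h
        have hc : ((1 + Polynomial.X ^ 2 : Polynomial R) ^ (n - k)).coeff 0 = 1 := by
          rw [Polynomial.coeff_zero_eq_eval_zero]
          simp
        rw [hc, mul_one] at h
        rw [← sub_eq_of_eq_add h]
        refine S.sub_mem (Subring.subset_closure ⟨k, hk0, hk, rfl⟩) (S.sum_mem fun m hm => ?_)
        split_ifs with hmk
        · have hlt : m < k := lt_of_le_of_ne hmk (Finset.ne_of_mem_erase hm)
          exact S.mul_mem (ih m hlt (by omega)) (hint _ _)
        · exact S.zero_mem
  rintro _ ⟨H, hH, rfl⟩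
  obtain ⟨P, rfl⟩ := exists_aeval_esymm_of_isSymmetric hH
  change MvPolynomial.aeval y _ ∈ S
  rw [MvPolynomial.comp_aeval_apply]
  refine aeval_int_mem S (fun i => ?_) P
  rw [aeval_esymm_eq_sum]
  exact he _ i.2

/-- The values `χ(t ^ i)` are the power sums of the `2 n` numbers `t_j ^ 2`, `t_j ^ (-2)`. The
factors of a pair multiply to `1 + y_j q + q ^ 2`. -/
theorem coeff_lamFun_chi (n k : ℕ) :
    PowerSeries.coeff k (lamFun (chi n)) = quadCoeff (yFun : Fin n → TorusFun n) k := by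
  funext t
  let u : Fin n ⊕ Fin n → ℂ := Sum.elim (fun i => (t i : ℂ) ^ 2) (fun i => (t i : ℂ) ^ (-2 : ℤ))
  have h : (fun i => chi n (t ^ i)) = fun i : ℕ => ∑ j, u j ^ i := by
    funext i
    simp only [chi, u, Fintype.sum_sum_type, Sum.elim_inl, Sum.elim_inr, Finset.sum_add_distrib,
      Pi.pow_apply, Units.val_pow_eq_pow_val]
    congr 1 <;> refine Finset.sum_congr rfl fun j _ => ?_
    · rw [pow_right_comm]
    · rw [← zpow_natCast, ← zpow_natCast, ← zpow_mul, ← zpow_mul, mul_comm]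
  have hr := map_quadCoeff (Pi.evalRingHom (fun _ : Fin n → ℂˣ => ℂ) t)
    (yFun : Fin n → TorusFun n) k
  rw [coeff_lamFun, h, newtonCoeff_powerSum]
  refine Eq.trans ?_ hr.symm
  rw [quadCoeff, Fintype.prod_sum_type, ← Finset.prod_mul_distrib]
  congr 1
  refine Finset.prod_congr rfl fun j _ => ?_
  have hu : (t j : ℂ) ^ 2 * (t j : ℂ) ^ (-2 : ℤ) = 1 := by
    rw [← zpow_natCast, ← zpow_add₀ (t j).ne_zero]
    simp
  have hu' := congrArg (Polynomial.C : ℂ → Polynomial ℂ) hu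
  rw [Polynomial.C_mul, Polynomial.C_1] at hu'
  simp only [u, Sum.elim_inl, Sum.elim_inr, Pi.evalRingHom_apply, yFun, Polynomial.C_add]
  linear_combination Polynomial.X ^ 2 * hu'

/-! ### The ring of polynomial characters -/

/-- Elements of `Rep(G)` are integral Laurent polynomials on `T`, so the symmetric polynomial in the
`y_i` from `mem_repPolyC_iff` has integral coefficients. -/
theorem mem_repPoly_iff {X : ClassicalType} {n : ℕ} (x : repRing X n) :
    x ∈ repPoly X n ↔ (x : TorusFun n) ∈ symSubring (yFun : Fin n → TorusFun n) := by
  have hval : ∀ (H₀ : MvPolynomial (Fin n) ℤ) (t : Fin n → ℂˣ),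
      MvPolynomial.eval₂Hom (Int.castRingHom (TorusFun n)) (yFun : Fin n → TorusFun n) H₀ t =
        MvPolynomial.eval (fun i => yFun i t) (MvPolynomial.map (Int.castRingHom ℂ) H₀) := by
    intro H₀ t
    refine (map_aeval_int (Pi.evalRingHom (fun _ : Fin n → ℂˣ => ℂ) t) _ H₀).trans ?_
    rw [MvPolynomial.eval_map, MvPolynomial.aeval_def]
    rfl
  have hmem : x ∈ repPoly X n ↔ (x : TorusFun n) ∈ repPolyC X n := Iff.rfl
  rw [hmem, mem_repPolyC_iff]
  constructor
  · rintro ⟨H, hH, hx⟩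
    have hx' : (x : TorusFun n) = fun t => MvPolynomial.eval (fun i => yFun i t) H := funext hx
    obtain ⟨H₀, hH₀, rfl⟩ := exists_int_polynomial hH
      (by rw [← hx']; exact repRing_le_intLaurentRing X n x.2)
    exact ⟨H₀, hH₀, funext fun t => by rw [hx, hval]⟩
  · rintro ⟨H₀, hH₀, hx⟩
    refine ⟨MvPolynomial.map (Int.castRingHom ℂ) H₀, fun e => ?_, fun t => ?_⟩
    · rw [← MvPolynomial.map_rename, hH₀ e]
    · rw [← hx, hval]

/-- The function `chi` as an element of the representation ring. -/
def chiRep (X : ClassicalType) (n : ℕ) : repRing X n := ⟨chi n, chi_mem_repRing X n⟩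

theorem coe_coeff_lamRep_chiRep (X : ClassicalType) (n k : ℕ) :
    ((PowerSeries.coeff k (lamRep X n (chiRep X n)) : repRing X n) : TorusFun n) =
      quadCoeff (yFun : Fin n → TorusFun n) k := by
  rw [coe_coeff_lamRep]
  exact coeff_lamFun_chi n k

theorem coeff_lamRep_chiRep_mem (X : ClassicalType) (n k : ℕ) :
    PowerSeries.coeff k (lamRep X n (chiRep X n)) ∈ repPoly X n := by
  rw [mem_repPoly_iff, coe_coeff_lamRep_chiRep]
  exact quadCoeff_mem_symSubring _ k

theorem closure_eq_repPoly (X : ClassicalType) (n : ℕ) :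
    Subring.closure {y | ∃ i : ℕ, 1 ≤ i ∧ i ≤ n ∧
      y = PowerSeries.coeff i (lamRep X n (chiRep X n))} = repPoly X n := by
  apply le_antisymm
  · rw [Subring.closure_le]
    rintro _ ⟨i, -, -, rfl⟩
    exact coeff_lamRep_chiRep_mem X n i
  · intro x hx
    have h := symSubring_le_closure _ ((mem_repPoly_iff x).1 hx)
    have himage : {z : TorusFun n | ∃ i : ℕ, 1 ≤ i ∧ i ≤ n ∧
        z = quadCoeff (yFun : Fin n → TorusFun n) i} = (repRing X n).subtype ''
        {y | ∃ i : ℕ, 1 ≤ i ∧ i ≤ n ∧ y = PowerSeries.coeff i (lamRep X n (chiRep X n))} := by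
      ext z
      constructor
      · rintro ⟨i, h1, h2, rfl⟩
        exact ⟨_, ⟨i, h1, h2, rfl⟩, coe_coeff_lamRep_chiRep X n i⟩
      · rintro ⟨_, ⟨i, h1, h2, rfl⟩, rfl⟩
        exact ⟨i, h1, h2, coe_coeff_lamRep_chiRep X n i⟩
    rw [himage, ← RingHom.map_closure] at h
    obtain ⟨y, hy, e⟩ := h
    have : y = x := Subtype.ext e
    rwa [← this]

/-- It suffices to treat the generators `λ^i(χ)`, and `λ^k(λ^i(χ))` is an integral polynomial in the
`λ^j(χ)` with `j ≤ k * i`. Here `j` may exceed `n`, so membership of `λ^j(χ)` is needed in every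
degree. -/
theorem isLambdaStable_repPoly (X : ClassicalType) (n : ℕ) :
    IsLambdaStable (lamRep X n) (repPoly X n) := by
  intro x hx k
  have hs := isSpecialLambdaRing_lamRep X n
  rw [← closure_eq_repPoly] at hx
  refine coeff_mem_of_mem_closure hs ?_ hx k
  rintro _ ⟨i, h1, -, rfl⟩ k
  rcases Nat.eq_zero_or_pos k with rfl | hk
  · rw [hs.coeff_zero]
    exact Subring.one_mem _
  · obtain ⟨P, -, hP⟩ := hs.comp k i hk h1
    rw [hP]
    exact aeval_int_mem _ (fun j => coeff_lamRep_chiRep_mem X n _) P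

end SpringerRep

end

theorem lemma6p5 (X : SpringerRep.ClassicalType) (n : ℕ) :
    (∃! lam : SpringerRep.repRing X n → PowerSeries (SpringerRep.repRing X n),
      SpringerRep.IsExteriorLambda lam) ∧
    ∀ lam : SpringerRep.repRing X n → PowerSeries (SpringerRep.repRing X n),
      SpringerRep.IsExteriorLambda lam →
      SpringerRep.IsSpecialLambdaRing lam ∧
      SpringerRep.IsSpecialLambdaSubring lam (SpringerRep.repPoly X n) ∧
      ∃ c : SpringerRep.repRing X n, (c : SpringerRep.TorusFun n) = SpringerRep.chi n ∧
        c ∈ SpringerRep.repPoly X n ∧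
        Subring.closure {y | ∃ i : ℕ, 1 ≤ i ∧ i ≤ n ∧ y = PowerSeries.coeff i (lam c)} =
          SpringerRep.repPoly X n ∧
        ∀ S : Subring (SpringerRep.repRing X n), SpringerRep.IsLambdaStable lam S → c ∈ S →
          SpringerRep.repPoly X n ≤ S  := by
  refine ⟨⟨SpringerRep.lamRep X n, SpringerRep.isExteriorLambda_lamRep X n,
    fun lam h => SpringerRep.eq_lamRep h⟩, fun lam h => ?_⟩
  obtain rfl := SpringerRep.eq_lamRep h
  have hs := SpringerRep.isSpecialLambdaRing_lamRep X n
  refine ⟨hs, SpringerRep.isSpecialLambdaSubring_of_isLambdaStable hs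
    (SpringerRep.isLambdaStable_repPoly X n), SpringerRep.chiRep X n, rfl, ?_,
    SpringerRep.closure_eq_repPoly X n, fun S hS hc => ?_⟩
  · have := SpringerRep.coeff_lamRep_chiRep_mem X n 1
    rwa [hs.coeff_one] at this
  · rw [← SpringerRep.closure_eq_repPoly, Subring.closure_le]
    rintro _ ⟨i, -, -, rfl⟩
    exact hS _ hc i
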